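/- **Theorem 3.4 (reproducing kernel of $H_2^{(n)}$).** Let $\mathbb{C}^+=\{z\in\mathbb{C}:\Im z>0\}$ and let $H_2$ be the Hardy space of all holomorphic $f$ on $\mathbb{C}^+$ with $$\sup_{y>0}\frac1{2\pi}\int_{-\infty}^{\infty}|f(x+iy)|^2\,dx<\infty .$$ Let $n\ge 1$ be an integer, and let $H_2^{(n)}$ be the space of all holomorphic $F$ on $\mathbb{C}^+$ such that $z^kF^{(k)}\in H_2$ for $k=0,1,\dots,n$, endowed with the inner product $$\langle F,G\rangle_{H_2^{(n)}}=\frac1{2\pi}\int_{-\infty}^{\infty}x^{2n}\,(F^*)^{(n)}(x)\,\overline{(G^*)^{(n)}(x)}\,dx ,$$ where $F^*(x)=\lim_{y\to0^+}F(x+iy)$. (For $F\in H_2^{(n)}$ the limit exists at every $x\in\mathbb{R}\setminus\{0\}$, and $F^*$ is $n$ times differentiable at almost every $x$.) Then the function $$K_n(z,w)=\frac{1}{((n-1)!)^2}\int_0^1\!\int_0^1(1-y)^{n-1}(1-x)^{n-1}\frac{i}{yz-x\overline w}\,dx\,dy,\qquad z,w\in\mathbb{C}^+,$$ where the double integral converges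 absolutely, is the reproducing kernel of $H_2^{(n)}$. That is, for every $w\in\mathbb{C}^+$ the function $K_{n,w}(z)=K_n(z,w)$ belongs to $H_2^{(n)}$, and for every $F\in H_2^{(n)}$ the integral defining $\langle F,K_{n,w}\rangle_{H_2^{(n)}}$ converges absolutely and $$F(w)=\langle F,K_{n,w}\rangle_{H_2^{(n)}}.$$ -/

import Mathlib

open scoped Topology

noncomputable section

namespace HardySobolev

/-- The open upper half-plane, as a subset of `ℂ`. -/
def upperHalf : Set ℂ := {z : ℂ | 0 < z.im}

/-- The Hardy space `H₂` of the upper half-plane. Functions are total on `ℂ`, but only their values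
on the half-plane matter; the integrals are taken in `[0, ∞]`. -/
def hardy : Set (ℂ → ℂ) :=
  {f | DifferentiableOn ℂ f upperHalf ∧
    (⨆ y ∈ Set.Ioi (0 : ℝ),
      (ENNReal.ofReal (2 * Real.pi))⁻¹ *
        ∫⁻ x : ℝ, ‖f ((x : ℂ) + (y : ℂ) * Complex.I)‖ₑ ^ 2) < ⊤}

/-- The Hardy-Sobolev space: holomorphic `F` on the upper half-plane such that
`z ^ k * F⁽ᵏ⁾(z)` belongs to `H₂` for `k = 0, …, n`. -/
def hardySobolev (n : ℕ) : Set (ℂ → ℂ) :=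
  {F | DifferentiableOn ℂ F upperHalf ∧
    ∀ k ≤ n, (fun z : ℂ => z ^ k * iteratedDeriv k F z) ∈ hardy}

/-- The boundary function `F*(x) = lim_{y → 0+} F(x + iy)` on the real line. -/
def boundary (F : ℂ → ℂ) (x : ℝ) : ℂ :=
  Filter.limUnder (𝓝[>] (0 : ℝ)) (fun y : ℝ => F ((x : ℂ) + (y : ℂ) * Complex.I))

/-- The integrand `x ^ (2n) (F*)⁽ⁿ⁾(x) conj((G*)⁽ⁿ⁾(x))` of the inner product. -/
def innerIntegrand (n : ℕ) (F G : ℂ → ℂ) (x : ℝ) : ℂ :=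
  (x : ℂ) ^ (2 * n) * iteratedDeriv n (boundary F) x *
    (starRingEnd ℂ) (iteratedDeriv n (boundary G) x)

/-- The inner product of the Hardy-Sobolev space, linear in the first variable, with the
normalization `1 / (2π)` of the inner product of `H₂`. -/
def inner (n : ℕ) (F G : ℂ → ℂ) : ℂ :=
  1 / (2 * (Real.pi : ℂ)) * ∫ x : ℝ, innerIntegrand n F G x

/-- The integrand `(1 - y) ^ (n - 1) (1 - x) ^ (n - 1) i / (y z - x conj w)` of the kernel. -/
def kernelIntegrand (n : ℕ) (z w : ℂ) (x y : ℝ) : ℂ :=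
  (1 - (y : ℂ)) ^ (n - 1) * (1 - (x : ℂ)) ^ (n - 1) *
    (Complex.I / ((y : ℂ) * z - (x : ℂ) * (starRingEnd ℂ) w))

/-- The kernel `K_n(z, w)` (used for `n ≥ 1`). -/
def kernel (n : ℕ) (z w : ℂ) : ℂ :=
  1 / ((n - 1).factorial : ℂ) ^ 2 *
    ∫ y in (0 : ℝ)..1, ∫ x in (0 : ℝ)..1, kernelIntegrand n z w x y

end HardySobolev

end

/-!
The kernel comes from two classical formulas. For `F` in the Hardy-Sobolev space put
`G(z) = z ^ n * F⁽ⁿ⁾(z)`, a function of the Hardy space. Taylor's formula along the ray from `w` to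
infinity, with the parameter `t = 1 / y`, has no boundary terms at infinity (`G` and its lower
analogues decay along the ray), and reads
`F(w) = (-1)ⁿ / (n - 1)! * ∫₀¹ (1 - y) ^ (n - 1) * y⁻¹ * G(w / y) dy` (`taylor_integral`).
Cauchy's formula for `H₂` writes `y⁻¹ * G(w / y)` as an integral of the boundary function of `G`
against `-i / (2π (y x - w))`. After an exchange of integrals `F(w)` is the `L²` pairing of the
boundary function of `G` with `(-1)ⁿ / (n - 1)! * ∫₀¹ (1 - y) ^ (n - 1) * i / (y z - conj w) dy`,
    and
this last function is `z ^ n * K⁽ⁿ⁾(z)` for `K = K_n(·, w)` (`pow_mul_kernelDeriv`), because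
`((1 - x) / (a - x b)) ^ n` is an antiderivative of a multiple of
`(1 - x) ^ (n - 1) / (a - x b) ^ (n + 1)`.

Nontangential limits of `H₂` functions are not needed. The horizontal slices of `G` are bounded in
`L²`, so by Banach-Alaoglu they converge weakly along an ultrafilter of heights tending to `0`; the
weak limit `g` satisfies Cauchy's formula, as the Cauchy kernel is in `L²`. Moreover `g` is the
boundary derivative in the classical sense. The bound `|f(z)| ≤ C (Im z) ^ (-1/2)` on `H₂`, applied
to `z ^ (k + 1) * F⁽ᵏ⁺¹⁾`, makes `F⁽ᵏ⁾(x + i y)` for `k < n` converge as `y → 0`, locally uniformly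
off `x = 0`, so that the limits are successive derivatives of `F*`. Integrating
`(z ^ n * F⁽ⁿ⁻¹⁾)' = n * z ^ (n - 1) * F⁽ⁿ⁻¹⁾ + G` over a horizontal segment and letting `y → 0`
exhibits `x ^ n * (F*)⁽ⁿ⁻¹⁾` as an integral, and Lebesgue's differentiation theorem gives
`(F*)⁽ⁿ⁾ = g / x ^ n` almost everywhere (`ae_hasDerivAt_boundary`).

For the kernel everything follows from `|y z - x conj w| ≥ c (y |z| + x |w|)`, valid on a sector
slightly larger than the closed half-plane: it gives absolute convergence, holomorphy across
`ℝ \ {0}`, and the bounds `|z ^ k * K⁽ᵏ⁾(z)| ≤ C |z| ^ (-s)` for all `s ∈ (0, 1)`, whose cases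
`s = 1/4` near the origin and `s = 3/4` near infinity place `z ^ k * K⁽ᵏ⁾` in `H₂`.
-/

namespace HardySobolev

open MeasureTheory Set Filter Complex

/-! ### Pointwise bounds in the Hardy space -/

lemma isOpen_upperHalf : IsOpen upperHalf := isOpen_lt continuous_const Complex.continuous_im

lemma mem_upperHalf {z : ℂ} : z ∈ upperHalf ↔ 0 < z.im := Iff.rfl

/-- The supremum in the definition of `hardy`, as a bound for each slice, without the factor
`1 / (2π)`. -/
lemma hardy_exists_lintegral_le {f : ℂ → ℂ} (hf : f ∈ hardy) :
    ∃ C : ENNReal, C ≠ ⊤ ∧ ∀ y : ℝ, 0 < y →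
      ∫⁻ x : ℝ, ‖f ((x : ℂ) + (y : ℂ) * Complex.I)‖ₑ ^ 2 ≤ C := by
  obtain ⟨-, h⟩ := hf
  set S := ⨆ y ∈ Set.Ioi (0 : ℝ), (ENNReal.ofReal (2 * Real.pi))⁻¹ *
        ∫⁻ x : ℝ, ‖f ((x : ℂ) + (y : ℂ) * Complex.I)‖ₑ ^ 2 with hS
  refine ⟨ENNReal.ofReal (2 * Real.pi) * S, ENNReal.mul_ne_top ENNReal.ofReal_ne_top h.ne, ?_⟩
  intro y hy
  have h1 : (ENNReal.ofReal (2 * Real.pi))⁻¹ *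
        ∫⁻ x : ℝ, ‖f ((x : ℂ) + (y : ℂ) * Complex.I)‖ₑ ^ 2 ≤ S :=
    le_iSup₂_of_le y hy le_rfl
  have hp : ENNReal.ofReal (2 * Real.pi) ≠ 0 := by simp [Real.pi_pos]
  calc _ = ENNReal.ofReal (2 * Real.pi) * ((ENNReal.ofReal (2 * Real.pi))⁻¹ *
        ∫⁻ x : ℝ, ‖f ((x : ℂ) + (y : ℂ) * Complex.I)‖ₑ ^ 2) := by
        rw [← mul_assoc, ENNReal.mul_inv_cancel hp ENNReal.ofReal_ne_top, one_mul]
    _ ≤ _ := by gcongr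

/-- The mean value property of `f ^ 2`, as an inequality in `[0, ∞]` over a circle that is
parametrized as in polar coordinates. -/
lemma two_pi_mul_enorm_sq_le {f : ℂ → ℂ} {c : ℂ} {R r : ℝ}
    (hf : DifferentiableOn ℂ f (Metric.ball c R))
    (hr : 0 < r) (hrR : r < R) :
    ENNReal.ofReal (2 * Real.pi) * ‖f c‖ₑ ^ 2 ≤
      ∫⁻ θ in Ioo (-Real.pi) Real.pi, ‖f (c + r * Complex.exp (θ * I))‖ₑ ^ 2 := by
  have h1 : DiffContOnCl ℂ (fun z => f z ^ 2) (Metric.ball c |r|) := by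
    have : closure (Metric.ball c |r|) ⊆ Metric.ball c R := by
      rw [abs_of_pos hr]
      exact Metric.closure_ball_subset_closedBall.trans (Metric.closedBall_subset_ball hrR)
    exact ((hf.mono this).pow 2).diffContOnCl
  have h2 := h1.circleAverage
  rw [Real.circleAverage_eq_integral_add (-Real.pi)] at h2
  rw [intervalIntegral.integral_comp_add_right (fun θ => f (circleMap c r θ) ^ 2),
    intervalIntegral.integral_of_le (by linarith [Real.pi_pos]), zero_add,
    show 2 * Real.pi + -Real.pi = Real.pi by ring, integral_Ioc_eq_integral_Ioo] at h2
  have h3 : ∫ θ in Ioo (-Real.pi) Real.pi, f (circleMap c r θ) ^ 2 = (2 * Real.pi : ℝ) • f c ^ 2 := by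
    rw [← h2, smul_smul, mul_inv_cancel₀ (by positivity), one_smul]
  calc _ = ‖(2 * Real.pi : ℝ) • f c ^ 2‖ₑ := by
        rw [enorm_smul, enorm_pow, Real.enorm_of_nonneg (by positivity)]
    _ ≤ ∫⁻ θ in Ioo (-Real.pi) Real.pi, ‖f (circleMap c r θ) ^ 2‖ₑ := by
        rw [← h3]; exact enorm_integral_le_lintegral_enorm _
    _ = _ := by simp only [enorm_pow, circleMap]

/-- Pointwise growth of a Hardy function. The area mean value property on the disc of radius
`Im z` around `z` bounds `|f z| ^ 2` by the integral of `|f| ^ 2` over a strip of height `2 Im z`,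
divided by the area of the disc. -/
lemma hardy_exists_norm_le {f : ℂ → ℂ} (hf : f ∈ hardy) :
    ∃ C : ℝ, 0 ≤ C ∧ ∀ z ∈ upperHalf, ‖f z‖ ≤ C * z.im ^ (-(1 / 2) : ℝ) := by
  obtain ⟨C, hC, hfC⟩ := hardy_exists_lintegral_le hf
  have key : ∀ z ∈ upperHalf, ENNReal.ofReal (z.im / 2) * (ENNReal.ofReal (z.im / 2) *
      (ENNReal.ofReal (2 * Real.pi) * ‖f z‖ₑ ^ 2)) ≤ ENNReal.ofReal (2 * z.im) * C := by
    intro z hz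
    have hz' : 0 < z.im := hz
    set R := z.im with hR
    have hsub : Metric.ball z R ⊆ upperHalf := by
      intro u hu
      rw [Metric.mem_ball, dist_eq_norm] at hu
      have := (Complex.abs_im_le_norm (u - z)).trans_lt hu
      rw [Complex.sub_im, abs_lt] at this
      rw [mem_upperHalf]; linarith [this.1]
    set φ : ℂ → ENNReal := fun ζ => (Metric.ball (0 : ℂ) R).indicator (fun ζ => ‖f (z + ζ)‖ₑ ^ 2) ζ
      with hφ
    have hφm : Measurable φ := by
      have hc : ContinuousOn (fun ζ => ‖f (z + ζ)‖ₑ ^ 2) (Metric.ball (0 : ℂ) R) := by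
        refine (ENNReal.continuous_pow 2).comp_continuousOn (ContinuousOn.enorm ?_)
        refine hf.1.continuousOn.comp (by fun_prop) fun u hu => hsub ?_
        simpa using hu
      rw [hφ]
      classical
      simp only [← Set.piecewise_eq_indicator]
      exact hc.measurable_piecewise continuousOn_const Metric.isOpen_ball.measurableSet
    have up : ∫⁻ ζ, φ ζ ≤ ENNReal.ofReal (2 * R) * C := by
      rw [← (Complex.volume_preserving_equiv_real_prod.symm).lintegral_comp_emb
        measurableEquivRealProd.symm.measurableEmbedding, Measure.volume_eq_prod,
        lintegral_prod_symm']
      · calc _ ≤ ∫⁻ y, (Ioo (-R) R).indicator (fun _ => C) y := by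
              refine lintegral_mono fun y => ?_
              by_cases hy : y ∈ Ioo (-R) R
              · rw [indicator_of_mem hy]
                calc _ ≤ ∫⁻ x : ℝ, ‖f (((x + z.re : ℝ) : ℂ) + ((y + z.im : ℝ) : ℂ) * I)‖ₑ ^ 2 := by
                      refine lintegral_mono fun x => ?_
                      refine (indicator_le_self' (by simp) _).trans (le_of_eq ?_)
                      congr 3
                      apply Complex.ext <;> simp [Complex.measurableEquivRealProd_symm_apply,
                          add_comm]
                  _ = ∫⁻ x : ℝ, ‖f ((x : ℂ) + ((y + z.im : ℝ) : ℂ) * I)‖ₑ ^ 2 :=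
                      lintegral_add_right_eq_self
                          (fun x : ℝ => ‖f ((x : ℂ) + ((y + z.im : ℝ) : ℂ) * I)‖ₑ ^ 2) z.re
                  _ ≤ C := hfC _ (by linarith [hy.1])
              · rw [indicator_of_notMem hy]
                rw [nonpos_iff_eq_zero]
                refine (lintegral_congr fun x => ?_).trans lintegral_zero
                refine indicator_of_notMem (fun hx => hy ?_) _
                rw [Metric.mem_ball, dist_zero_right] at hx
                have := (Complex.abs_im_le_norm _).trans_lt hx
                simpa [abs_lt, Complex.measurableEquivRealProd_symm_apply] using this
          _ = _ := by
              rw [lintegral_indicator measurableSet_Ioo, setLIntegral_const, Real.volume_Ioo,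
                  mul_comm]
              congr 2; ring
      · exact hφm.comp measurableEquivRealProd.symm.measurable
    -- In polar coordinates the annulus `R / 2 < r < R` already has a fixed share of the disc.
    have lo : ENNReal.ofReal (R / 2) * (ENNReal.ofReal (R / 2) *
      (ENNReal.ofReal (2 * Real.pi) * ‖f z‖ₑ ^ 2)) ≤ ∫⁻ ζ, φ ζ := by
      rw [← Complex.lintegral_comp_polarCoord_symm, polarCoord_target, Measure.volume_eq_prod,
        ← Measure.prod_restrict, lintegral_prod _ (by
          refine Measurable.aemeasurable ?_
          have : Measurable Complex.polarCoord.symm :=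
            measurableEquivRealProd.symm.measurable.comp continuous_polarCoord_symm.measurable
          exact (ENNReal.measurable_ofReal.comp measurable_fst).mul (hφm.comp this))]
      calc _ = ∫⁻ r in Ioo (R / 2) R, (ENNReal.ofReal (R / 2) *
              (ENNReal.ofReal (2 * Real.pi) * ‖f z‖ₑ ^ 2)) := by
            rw [setLIntegral_const, Real.volume_Ioo, mul_comm]
            congr 2; ring
        _ ≤ ∫⁻ r in Ioo (R / 2) R, ∫⁻ θ in Ioo (-Real.pi) Real.pi,
            ENNReal.ofReal r • φ (Complex.polarCoord.symm (r, θ)) := by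
            refine setLIntegral_mono' measurableSet_Ioo fun r hr => ?_
            simp only [smul_eq_mul]
            rw [lintegral_const_mul' _ _ ENNReal.ofReal_ne_top]
            gcongr
            · exact hr.1.le
            · have hr0 : 0 < r := by linarith [hr.1]
              refine (two_pi_mul_enorm_sq_le (hf.1.mono hsub) hr0 hr.2).trans (le_of_eq ?_)
              refine lintegral_congr fun θ => ?_
              have e : Complex.polarCoord.symm (r, θ) = r * Complex.exp (θ * I) := by
                rw [Complex.polarCoord_symm_apply, Complex.exp_mul_I, Complex.ofReal_cos,
                    Complex.ofReal_sin]
              rw [hφ]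
              simp only [e]
              rw [indicator_of_mem]
              rw [Metric.mem_ball, dist_zero_right, norm_mul, Complex.norm_exp_ofReal_mul_I]
              simpa [abs_of_pos hr0] using hr.2
        _ ≤ _ := lintegral_mono_set fun r hr => by
            have := hr.1; simp only [mem_Ioi]; linarith
    exact lo.trans up
  refine ⟨Real.sqrt (4 * C.toReal / Real.pi), Real.sqrt_nonneg _, fun z hz => ?_⟩
  have hz' : 0 < z.im := hz
  have k := ENNReal.toReal_mono (by finiteness) (key z hz)
  simp only [ENNReal.toReal_mul, ENNReal.toReal_pow, toReal_enorm] at k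
  rw [ENNReal.toReal_ofReal (by positivity), ENNReal.toReal_ofReal (by positivity),
    ENNReal.toReal_ofReal (by positivity)] at k
  rw [Real.rpow_neg hz'.le, ← Real.sqrt_eq_rpow, ← Real.sqrt_inv, ← Real.sqrt_mul (by positivity)]
  refine Real.le_sqrt_of_sq_le ?_
  have hpi := Real.pi_pos
  rw [div_mul_eq_mul_div, le_div_iff₀ hpi, ← div_eq_mul_inv, le_div_iff₀ hz']
  refine le_of_mul_le_mul_left ?_ hz'
  nlinarith [k]

/-! ### Cauchy's formula on horizontal lines -/

/-- Cauchy's theorem on the closed upper half-plane for functions that are `O(|z| ^ (-2))`: on the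
boundary of the rectangle `[-R, R] × [0, R]` all sides but the real one contribute `O(1 / R)`. -/
lemma integral_eq_zero_of_decay {q : ℂ → ℂ} (hc : ContinuousOn q {z | 0 ≤ z.im})
    (hd : DifferentiableOn ℂ q upperHalf) {C R₀ : ℝ}
    (hb : ∀ z : ℂ, 0 ≤ z.im → R₀ ≤ ‖z‖ → ‖q z‖ ≤ C / ‖z‖ ^ 2)
    (hi : Integrable fun x : ℝ => q x) : ∫ x : ℝ, q x = 0 := by
  have t1 : Tendsto (fun R : ℝ => ∫ x in (-R)..R, q x) atTop (𝓝 (∫ x : ℝ, q x)) :=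
    intervalIntegral_tendsto_integral hi tendsto_neg_atTop_atBot tendsto_id
  refine tendsto_nhds_unique t1 (squeeze_zero_norm' (a := fun R => 4 * C / R) ?_ ?_)
  · filter_upwards [eventually_ge_atTop (max R₀ 1)] with R hR
    have hR0 : R₀ ≤ R := (le_max_left _ _).trans hR
    have hR1 : 0 < R := one_pos.trans_le ((le_max_right _ _).trans hR)
    have bound : ∀ z : ℂ, 0 ≤ z.im → R ≤ ‖z‖ → ‖q z‖ ≤ C / R ^ 2 := by
      intro z hz hzR
      have h1 := hb z hz (hR0.trans hzR)
      have hC : 0 ≤ C := by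
        by_contra hneg
        have : C / ‖z‖ ^ 2 < 0 := div_neg_of_neg_of_pos (not_le.mp hneg)
            (by have := hR1.trans_le hzR; positivity)
        linarith [norm_nonneg (q z)]
      exact h1.trans (by gcongr)
    have key := integral_boundary_rect_eq_zero_of_continuousOn_of_differentiableOn q (-R : ℝ)
      ((R : ℝ) + (R : ℝ) * I) (hc.mono ?_) (hd.mono ?_)
    · simp only [ofReal_re, ofReal_im, add_re, mul_re, I_re, mul_zero, I_im, mul_one, sub_self,
        add_zero, add_im, mul_im, zero_add, ofReal_zero, zero_mul, smul_eq_mul] at key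
      have e : ∫ x in (-R)..R, q x = (∫ x : ℝ in (-R)..R, q (x + R * I)) -
          I * (∫ y : ℝ in (0 : ℝ)..R, q (R + y * I)) + I *
              (∫ y : ℝ in (0 : ℝ)..R, q ((-R : ℝ) + y * I)) := by
        linear_combination key
      have n1 : ‖∫ x : ℝ in (-R)..R, q (x + R * I)‖ ≤ C / R ^ 2 * |R - (-R)| := by
        refine intervalIntegral.norm_integral_le_of_norm_le_const fun x _ => bound _ ?_ ?_
        · simpa using hR1.le
        · refine le_trans (le_of_eq ?_) (abs_im_le_norm _)
          simp [abs_of_pos hR1]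
      have n2 : ∀ s : ℝ, |s| = R → ‖∫ y : ℝ in (0 : ℝ)..R, q (s + y * I)‖ ≤ C / R ^ 2 * |R - 0| := by
        intro s hs
        refine intervalIntegral.norm_integral_le_of_norm_le_const fun y hy => bound _ ?_ ?_
        · rw [uIoc_of_le hR1.le] at hy; simpa using hy.1.le
        · refine le_trans (le_of_eq ?_) (abs_re_le_norm _)
          simp [hs]
      have n3 := n2 R (abs_of_pos hR1)
      have n4 := n2 (-R) (by rw [abs_neg, abs_of_pos hR1])
      rw [e]
      calc _ ≤ ‖∫ x : ℝ in (-R)..R, q (x + R * I)‖ + ‖∫ y : ℝ in (0 : ℝ)..R, q (R + y * I)‖ +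
              ‖∫ y : ℝ in (0 : ℝ)..R, q ((-R : ℝ) + y * I)‖ := by
            refine (norm_add_le _ _).trans (add_le_add ((norm_sub_le _ _).trans ?_) ?_) <;> simp
        _ ≤ C / R ^ 2 * |R - (-R)| + C / R ^ 2 * |R - 0| + C / R ^ 2 * |R - 0| := by gcongr
        _ = 4 * C / R := by
            rw [abs_of_pos (by linarith), abs_of_pos (by linarith)]; field_simp; ring
    · intro z hz
      have := hz.2
      simp only [mem_preimage, ofReal_im, add_im, mul_im, ofReal_re, I_im, mul_one, I_re, mul_zero,
          add_zero, zero_add,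
        uIcc_of_le hR1.le] at this
      exact this.1
    · intro z hz
      have := hz.2
      simp only [mem_preimage, ofReal_im, add_im, mul_im, ofReal_re, I_im, mul_one, I_re, mul_zero,
          add_zero, zero_add,
        min_eq_left hR1.le] at this
      exact this.1
  · exact tendsto_const_nhds.div_atTop tendsto_id

lemma sub_ofReal_ne_zero {w : ℂ} (hw : w ∈ upperHalf) (x : ℝ) : (x : ℂ) - w ≠ 0 := by
  intro h
  have := congrArg Complex.im h
  rw [mem_upperHalf] at hw
  simp at this; linarith

lemma sub_conj_ne_zero {w z : ℂ} (hw : w ∈ upperHalf) (hz : 0 ≤ z.im) :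
    z - (starRingEnd ℂ) w ≠ 0 := by
  intro h
  have := congrArg Complex.im h
  rw [mem_upperHalf] at hw
  simp at this; linarith

/-- The square of the Cauchy kernel is a rescaled Poisson kernel. -/
lemma poisson_eq {w : ℂ} (hw : w ∈ upperHalf) (x : ℝ) :
    ‖((x : ℂ) - w)⁻¹‖ ^ 2 = (w.im ^ 2)⁻¹ * (1 + ((x - w.re) / w.im) ^ 2)⁻¹ := by
  have hw' : 0 < w.im := hw
  rw [norm_inv, inv_pow, ← Complex.normSq_eq_norm_sq, Complex.normSq_apply]
  simp
  field_simp
  ring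

lemma integrable_poisson {w : ℂ} (hw : w ∈ upperHalf) :
    Integrable fun x : ℝ => ‖((x : ℂ) - w)⁻¹‖ ^ 2 := by
  simp only [poisson_eq hw]
  exact (((integrable_inv_one_add_sq.comp_div (ne_of_gt hw)).comp_sub_right w.re)).const_mul _

lemma integral_poisson {w : ℂ} (hw : w ∈ upperHalf) :
    ∫ x : ℝ, ‖((x : ℂ) - w)⁻¹‖ ^ 2 = Real.pi / w.im := by
  have hw' : 0 < w.im := hw
  simp only [poisson_eq hw]
  rw [integral_const_mul, integral_sub_right_eq_self (fun x : ℝ => (1 + (x / w.im) ^ 2)⁻¹),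
    Measure.integral_comp_div (fun x : ℝ => (1 + x ^ 2)⁻¹), integral_univ_inv_one_add_sq,
    abs_of_pos hw', smul_eq_mul]
  field_simp

lemma memLp_inv_sub {w : ℂ} (hw : w ∈ upperHalf) :
    MemLp (fun x : ℝ => ((x : ℂ) - w)⁻¹) 2 := by
  refine (memLp_two_iff_integrable_sq_norm ?_).2 (integrable_poisson hw)
  refine Continuous.aestronglyMeasurable ?_
  exact Continuous.inv₀ (by fun_prop) (sub_ofReal_ne_zero hw)

lemma integral_cauchy_conj {w : ℂ} (hw : w ∈ upperHalf) :
    ∫ x : ℝ, (w - (starRingEnd ℂ) w) / ((x - (starRingEnd ℂ) w) * (x - w)) = 2 * Real.pi * I := by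
  have hw' : 0 < w.im := hw
  have e : ∀ x : ℝ, (w - (starRingEnd ℂ) w) / ((x - (starRingEnd ℂ) w) * (x - w)) =
      (2 * w.im * I) * ((‖((x : ℂ) - w)⁻¹‖ ^ 2 : ℝ) : ℂ) := by
    intro x
    have : (x : ℂ) - (starRingEnd ℂ) w = (starRingEnd ℂ) ((x : ℂ) - w) := by simp
    rw [this, mul_comm ((starRingEnd ℂ) _), Complex.mul_conj, sub_conj, norm_inv, inv_pow,
      Complex.normSq_eq_norm_sq, div_eq_mul_inv]
    push_cast; ring
  simp only [e]
  rw [integral_const_mul, integral_complex_ofReal, integral_poisson hw]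
  have : (w.im : ℂ) ≠ 0 := by exact_mod_cast hw'.ne'
  push_cast; field_simp

/-- Cauchy's formula on the upper half-plane for a bounded function whose restriction to the
real line is square integrable. -/
lemma integral_div_sub_eq {h : ℂ → ℂ} (hc : ContinuousOn h {z | 0 ≤ z.im})
    (hd : DifferentiableOn ℂ h upperHalf) {M : ℝ} (hM : ∀ z : ℂ, 0 ≤ z.im → ‖h z‖ ≤ M)
    (hL : MemLp (fun x : ℝ => h x) 2) {w : ℂ} (hw : w ∈ upperHalf) :
    ∫ x : ℝ, h x / (x - w) = 2 * Real.pi * I * h w := by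
  have hw' : 0 < w.im := hw
  have hint : Integrable fun x : ℝ => h x / (x - w) := by
    simp only [div_eq_mul_inv]
    exact hL.integrable_mul (memLp_inv_sub hw)
  -- The factor `1 / (1 - I ε z)` has norm at most `1` and makes the integrand `O(|z| ^ (-2))`.
  have lb : ∀ ε : ℝ, 0 < ε → ∀ z : ℂ, 0 ≤ z.im → 1 ≤ ‖1 - I * ε * z‖ ∧ ε * ‖z‖ ≤ ‖1 - I * ε * z‖ := by
    intro ε hε z hz
    have hp := mul_nonneg hε.le hz
    constructor
    · refine le_trans ?_ (Complex.abs_re_le_norm _)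
      simp
      rw [abs_of_pos] <;> linarith
    · refine le_of_sq_le_sq ?_ (norm_nonneg _)
      rw [mul_pow, ← Complex.normSq_eq_norm_sq, ← Complex.normSq_eq_norm_sq, Complex.normSq_apply,
          Complex.normSq_apply]
      simp
      nlinarith
  have main : ∀ ε : ℝ, 0 < ε →
      ∫ x : ℝ, (1 - I * ε * x)⁻¹ * (h x / (x - w)) = 2 * Real.pi * I * (h w / (1 - I * ε * w)) := by
    intro ε hε
    set c := h w / (1 - I * ε * w) with hcdef
    have hden : ∀ z : ℂ, 0 ≤ z.im → 1 - I * ε * z ≠ 0 := fun z hz => by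
      rw [← norm_pos_iff]; exact one_pos.trans_le (lb ε hε z hz).1
    -- The pole at `w` is removed by subtracting a multiple of `(w - conj w) / ((z - conj w) (z - w))`,
    -- whose integral is `2 π i` and which has the same decay.
    set k : ℂ → ℂ := fun z => h z / (1 - I * ε * z) -
      c * ((w - (starRingEnd ℂ) w) / (z - (starRingEnd ℂ) w)) with hk
    have hkw : k w = 0 := by
      simp only [hk]
      rw [div_self (sub_conj_ne_zero hw hw'.le), mul_one, sub_self]
    have hnw : {z : ℂ | 0 ≤ z.im} ∈ 𝓝 w :=
      mem_of_superset (isOpen_upperHalf.mem_nhds hw) fun z (hz : 0 < z.im) => hz.le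
    have hkc : ContinuousOn k {z | 0 ≤ z.im} := by
      refine (hc.div (by fun_prop) hden).sub (continuousOn_const.mul
        (continuousOn_const.div (by fun_prop) fun z hz => sub_conj_ne_zero hw hz))
    have hkd : DifferentiableOn ℂ k upperHalf := by
      refine (hd.div (by fun_prop) fun z hz => hden z (le_of_lt hz)).sub
        ((differentiableOn_const _).mul ((differentiableOn_const _).div (by fun_prop)
          fun z hz => sub_conj_ne_zero hw (le_of_lt hz)))
    have hq : ∀ z ≠ w, dslope k w z = k z / (z - w) := by
      intro z hz
      rw [dslope_of_ne _ hz, slope_def_field, hkw, sub_zero]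
    have hqx : ∀ x : ℝ, dslope k w x = (1 - I * ε * x)⁻¹ * (h x / (x - w)) -
        c * ((w - (starRingEnd ℂ) w) / ((x - (starRingEnd ℂ) w) * (x - w))) := by
      intro x
      have hx := sub_ofReal_ne_zero hw x
      rw [hq _ (sub_ne_zero.1 hx)]
      simp only [hk]
      have h2 : (x : ℂ) - (starRingEnd ℂ) w ≠ 0 := sub_conj_ne_zero hw (by simp)
      have h3 := hden x (by simp)
      field_simp
    have i1 : Integrable fun x : ℝ => (1 - I * ε * x)⁻¹ * (h x / (x - w)) := by
      refine hint.mono (AEStronglyMeasurable.mul ?_ hint.aestronglyMeasurable) ?_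
      · exact (Continuous.inv₀ (by fun_prop) fun x => hden _ (by simp)).aestronglyMeasurable
      · refine Eventually.of_forall fun x => ?_
        rw [norm_mul, norm_inv]
        exact mul_le_of_le_one_left (norm_nonneg _) (inv_le_one_of_one_le₀ (lb ε hε x (by simp)).1)
    have i2 : Integrable fun x : ℝ => c *
        ((w - (starRingEnd ℂ) w) / ((x - (starRingEnd ℂ) w) * (x - w))) := by
      refine Integrable.const_mul ?_ _
      refine Integrable.of_integral_ne_zero ?_
      rw [integral_cauchy_conj hw]
      simp [Real.pi_ne_zero]
    have z0 : ∫ x : ℝ, dslope k w x = 0 := by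
      refine integral_eq_zero_of_decay (C := 2 * M / ε + 4 * ‖c * (w - (starRingEnd ℂ) w)‖)
        (R₀ := 2 * ‖w‖) ((continuousOn_dslope hnw).2 ⟨hkc,
            (hkd w hw).differentiableAt (isOpen_upperHalf.mem_nhds hw)⟩)
        ((differentiableOn_dslope (isOpen_upperHalf.mem_nhds hw)).2 hkd) ?_ ?_
      · intro z hz hzw
        have hwn : 0 < ‖w‖ := norm_pos_iff.2 (by rintro rfl; simp at hw')
        have hzn : 0 < ‖z‖ := by linarith
        have d1 : ‖z‖ / 2 ≤ ‖z - w‖ := by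
          have := norm_sub_norm_le z w; linarith
        have d2 : ‖z‖ / 2 ≤ ‖z - (starRingEnd ℂ) w‖ := by
          have := norm_sub_norm_le z ((starRingEnd ℂ) w)
          rw [RCLike.norm_conj] at this; linarith
        have hzw' : z ≠ w := by rintro rfl; linarith
        have hM0 : 0 ≤ M := (norm_nonneg _).trans (hM z hz)
        rw [hq z hzw', norm_div]
        have kb : ‖k z‖ ≤ M / (ε * ‖z‖) + ‖c * (w - (starRingEnd ℂ) w)‖ / (‖z‖ / 2) := by
          refine (norm_sub_le _ _).trans (add_le_add ?_ ?_)
          · rw [norm_div]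
            exact div_le_div₀ hM0 (hM z hz) (by positivity) (lb ε hε z hz).2
          · rw [← mul_div_assoc, norm_div]; gcongr
        calc _ ≤ (M / (ε * ‖z‖) + ‖c * (w - (starRingEnd ℂ) w)‖ / (‖z‖ / 2)) / (‖z‖ / 2) := by
              gcongr
          _ = _ := by field_simp; ring
      · exact (i1.sub i2).congr (Eventually.of_forall fun x => (hqx x).symm)
    rw [integral_congr_ae (Eventually.of_forall hqx)] at z0
    rw [integral_sub i1 i2, integral_const_mul, integral_cauchy_conj hw] at z0
    linear_combination z0
  have t1 : Tendsto (fun ε : ℝ => ∫ x : ℝ, (1 - I * ε * x)⁻¹ * (h x / (x - w))) (𝓝[>] 0)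
      (𝓝 (∫ x : ℝ, h x / (x - w))) := by
    refine tendsto_integral_filter_of_dominated_convergence
        (fun x => ‖h x / (x - w)‖) ?_ ?_ hint.norm ?_
    · filter_upwards [self_mem_nhdsWithin] with ε hε
      refine AEStronglyMeasurable.mul ?_ hint.aestronglyMeasurable
      exact (Continuous.inv₀ (by fun_prop) fun x : ℝ => norm_pos_iff.1 (one_pos.trans_le
        (lb ε hε (x : ℂ) (by simp)).1)).aestronglyMeasurable
    · filter_upwards [self_mem_nhdsWithin] with ε hε
      refine Eventually.of_forall fun x => ?_
      rw [norm_mul, norm_inv]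
      exact mul_le_of_le_one_left (norm_nonneg _) (inv_le_one_of_one_le₀ (lb ε hε x (by simp)).1)
    · refine Eventually.of_forall fun x => ?_
      have : ContinuousAt (fun ε : ℝ => (1 - I * ε * x)⁻¹ * (h x / (x - w))) 0 := by
        refine ContinuousAt.mul (ContinuousAt.inv₀ (by fun_prop) (by simp)) continuousAt_const
      simpa using this.tendsto.mono_left nhdsWithin_le_nhds
  have t2 : Tendsto (fun ε : ℝ => 2 * Real.pi * I * (h w / (1 - I * ε * w))) (𝓝[>] 0)
      (𝓝 (2 * Real.pi * I * h w)) := by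
    have : ContinuousAt (fun ε : ℝ => 2 * Real.pi * I * (h w / (1 - I * ε * w))) 0 := by
      refine continuousAt_const.mul (continuousAt_const.div (by fun_prop) (by simp))
    simpa using this.tendsto.mono_left nhdsWithin_le_nhds
  refine tendsto_nhds_unique t1 (t2.congr' ?_)
  filter_upwards [self_mem_nhdsWithin] with ε hε
  exact (main ε hε).symm

lemma hardy_memLp_slice {f : ℂ → ℂ} (hf : f ∈ hardy) {y : ℝ} (hy : 0 < y) :
    MemLp (fun x : ℝ => f (x + y * I)) 2 := by
  obtain ⟨C, hC, hfC⟩ := hardy_exists_lintegral_le hf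
  have hm : Continuous (fun x : ℝ => f (x + y * I)) :=
    hf.1.continuousOn.comp_continuous (by fun_prop) fun x => by simpa [mem_upperHalf] using hy
  refine ⟨hm.aestronglyMeasurable, ?_⟩
  rw [eLpNorm_lt_top_iff_lintegral_rpow_enorm_lt_top (by norm_num) (by norm_num)]
  simpa using (hfC y hy).trans_lt hC.lt_top

/-- Cauchy's formula for the translate `f (· + i y)`, which is bounded on the closed half-plane. -/
lemma hardy_integral_slice_div_sub {f : ℂ → ℂ} (hf : f ∈ hardy) {y : ℝ} (hy : 0 < y) {w : ℂ}
    (hw : w ∈ upperHalf) :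
    ∫ x : ℝ, f (x + y * I) / (x - w) = 2 * Real.pi * I * f (w + y * I) := by
  obtain ⟨C, hC0, hC⟩ := hardy_exists_norm_le hf
  refine integral_div_sub_eq (h := fun z => f (z + y * I)) (M := C * y ^ (-(1 / 2) : ℝ)) ?_ ?_ ?_
    (hardy_memLp_slice hf hy) hw
  · refine hf.1.continuousOn.comp (by fun_prop) fun z (hz : 0 ≤ z.im) => ?_
    simp [mem_upperHalf]; linarith
  · refine hf.1.comp (by fun_prop) fun z (hz : 0 < z.im) => ?_
    simp [mem_upperHalf]; linarith
  · intro z hz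
    have hz1 : z + y * I ∈ upperHalf := by simp [mem_upperHalf]; linarith
    refine (hC _ hz1).trans ?_
    gcongr ?_ * ?_
    refine Real.rpow_le_rpow_of_nonpos hy ?_ (by norm_num)
    simpa using hz

/-! ### Weak boundary functions -/

/-- `g` is a weak boundary function of `f` along the ultrafilter `U` of heights `y → 0+`: it is
square integrable, and the horizontal slices `f (· + y I)` converge to it weakly in `L²`. The
pairing is bilinear, without conjugation. An ultrafilter takes the place of a subsequence, so that
compactness yields a limit at once. -/
structure IsWeakBoundary (f : ℂ → ℂ) (U : Ultrafilter ℝ) (g : ℝ → ℂ) : Prop where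
  le_nhdsGT : (U : Filter ℝ) ≤ 𝓝[>] 0
  memLp : MemLp g 2
  tendsto_integral : ∀ h : ℝ → ℂ, MemLp h 2 →
    Tendsto (fun y : ℝ => ∫ x : ℝ, f (x + y * I) * h x) U (𝓝 (∫ x : ℝ, g x * h x))

/-- By Banach-Alaoglu, since the slices of a Hardy function are bounded in `L²`. -/
lemma hardy_exists_isWeakBoundary {f : ℂ → ℂ} (hf : f ∈ hardy) :
    ∃ (U : Ultrafilter ℝ) (g : ℝ → ℂ), IsWeakBoundary f U g := by
  obtain ⟨C, hC, hfC⟩ := hardy_exists_lintegral_le hf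
  classical
  set v : ℝ → Lp ℂ 2 (volume : Measure ℝ) := fun y =>
    if hy : 0 < y then (hardy_memLp_slice hf hy).toLp _ else 0 with hv
  have hvn : ∀ y, ‖v y‖ ≤ Real.sqrt C.toReal := by
    intro y
    by_cases hy : 0 < y
    · simp only [hv, dif_pos hy, Lp.norm_toLp]
      rw [eLpNorm_eq_lintegral_rpow_enorm_toReal (by norm_num) (by norm_num), Real.sqrt_eq_rpow,
        ENNReal.toReal_rpow]
      refine ENNReal.toReal_mono (by finiteness) ?_
      simp only [ENNReal.toReal_ofNat, ENNReal.rpow_ofNat]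
      gcongr
      exact hfC y hy
    · simp [hv, hy]
  set U : Ultrafilter ℝ := Ultrafilter.of (𝓝[>] (0 : ℝ)) with hU
  have hUle : (U : Filter ℝ) ≤ 𝓝[>] 0 := Ultrafilter.of_le _
  set Φ : ℝ → WeakDual ℂ (Lp ℂ 2 (volume : Measure ℝ)) := fun y =>
    StrongDual.toWeakDual (InnerProductSpace.toDual ℂ _ (v y)) with hΦ
  obtain ⟨φ, -, hφ⟩ := (WeakDual.isCompact_closedBall (𝕜 := ℂ)
      (0 : StrongDual ℂ (Lp ℂ 2 (volume : Measure ℝ))) (Real.sqrt C.toReal)).ultrafilter_le_nhds'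
          (U.map Φ)
    (Ultrafilter.mem_map.2 (Filter.univ_mem' fun y => by
      simp only [mem_preimage, hΦ, Metric.mem_closedBall, dist_zero_right]
      exact ((InnerProductSpace.toDual ℂ (Lp ℂ 2 (volume : Measure ℝ))).norm_map (v y)).trans_le
        (hvn y)))
  set G : Lp ℂ 2 (volume : Measure ℝ) :=
      (InnerProductSpace.toDual ℂ _).symm (WeakDual.toStrongDual φ) with hG
  refine ⟨U, G, hUle, Lp.memLp G, fun h hh => ?_⟩
  -- The inner product of `L²` is conjugate linear in its first argument, whence the conjugates.
  have hh' : MemLp (fun x => (starRingEnd ℂ) (h x)) 2 := hh.star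
  have t1 : Tendsto (fun y => Φ y (hh'.toLp _)) U (𝓝 (φ (hh'.toLp _))) :=
    ((WeakDual.eval_continuous (hh'.toLp _)).tendsto φ).comp hφ
  have t2 := (Complex.continuous_conj.tendsto _).comp t1
  have e0 : ∀ (u : Lp ℂ 2 (volume : Measure ℝ)) (f : ℝ → ℂ), u =ᵐ[volume] f → 
      (starRingEnd ℂ) (Inner.inner ℂ u (hh'.toLp _)) = ∫ x : ℝ, f x * h x := by
    intro u f hu
    rw [L2.inner_def, ← integral_conj]
    refine integral_congr_ae ?_
    filter_upwards [hu, hh'.coeFn_toLp] with x hx hx'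
    simp [hx, hx', mul_comm]
  have e1 : (starRingEnd ℂ) (φ (hh'.toLp _)) = ∫ x : ℝ, G x * h x := by
    rw [← e0 G G ae_eq_rfl]
    have : InnerProductSpace.toDual ℂ _ G = WeakDual.toStrongDual φ := by simp [hG]
    rw [← InnerProductSpace.toDual_apply_apply, this]; rfl
  rw [← e1]
  refine t2.congr' ?_
  filter_upwards [hUle self_mem_nhdsWithin] with y hy
  have hy' : 0 < y := hy
  have := e0 (v y) (fun x => f (x + y * I)) (by
    simp only [hv, dif_pos hy']; exact (hardy_memLp_slice hf hy').coeFn_toLp)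
  rw [← this]
  simp only [hΦ, Function.comp_apply]
  rw [← InnerProductSpace.toDual_apply_apply]; rfl

/-- Cauchy's formula with the weak boundary function. -/
lemma IsWeakBoundary.integral_div_sub {f : ℂ → ℂ} {U : Ultrafilter ℝ} {g : ℝ → ℂ}
    (hg : IsWeakBoundary f U g) (hf : f ∈ hardy)
    {w : ℂ} (hw : w ∈ upperHalf) :
    ∫ x : ℝ, g x / (x - w) = 2 * Real.pi * I * f w := by
  have t1 := hg.tendsto_integral _ (memLp_inv_sub hw)
  simp only [div_eq_mul_inv]
  refine tendsto_nhds_unique t1 ?_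
  have t2 : Tendsto (fun y : ℝ => 2 * Real.pi * I * f (w + y * I)) (𝓝[>] 0)
      (𝓝 (2 * Real.pi * I * f w)) := by
    have h1 : ContinuousAt f (w + (0 : ℝ) * I) := by
      simpa using hf.1.continuousOn.continuousAt (isOpen_upperHalf.mem_nhds hw)
    have : ContinuousAt (fun y : ℝ => 2 * Real.pi * I * f (w + y * I)) 0 :=
      continuousAt_const.mul (ContinuousAt.comp (f := fun y : ℝ => w + y * I) h1 (by fun_prop))
    simpa using this.tendsto.mono_left nhdsWithin_le_nhds
  refine (t2.mono_left hg.le_nhdsGT).congr' ?_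
  filter_upwards [hg.le_nhdsGT self_mem_nhdsWithin] with y hy
  simp only [← div_eq_mul_inv]
  exact (hardy_integral_slice_div_sub hf hy hw).symm

lemma IsWeakBoundary.tendsto_intervalIntegral {f : ℂ → ℂ} {U : Ultrafilter ℝ} {g : ℝ → ℂ}
    (hg : IsWeakBoundary f U g)
    (a b : ℝ) :
    Tendsto (fun y : ℝ => ∫ x in a..b, f (x + y * I)) U (𝓝 (∫ x in a..b, g x)) := by
  wlog hab : a ≤ b generalizing a b
  · simp only [intervalIntegral.integral_symm b a]
    exact (this b a (not_le.1 hab).le).neg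
  have hm : MemLp ((Ioc a b).indicator fun _ : ℝ => (1 : ℂ)) 2 :=
    memLp_indicator_const 2 measurableSet_Ioc 1 (Or.inr (by simp))
  have e : ∀ φ : ℝ → ℂ, ∫ x in a..b, φ x = ∫ x : ℝ,
      φ x * (Ioc a b).indicator (fun _ : ℝ => (1 : ℂ)) x := by
    intro φ
    rw [intervalIntegral.integral_of_le hab, ← integral_indicator measurableSet_Ioc]
    refine integral_congr_ae (Eventually.of_forall fun x => ?_)
    by_cases hx : x ∈ Ioc a b <;> simp [hx]
  simp only [e]
  exact hg.tendsto_integral _ hm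

/-! ### Boundary values of the derivatives -/

section

lemma hasDerivAt_iteratedDeriv {F : ℂ → ℂ} (hF : DifferentiableOn ℂ F upperHalf) (k : ℕ) {z : ℂ}
    (hz : z ∈ upperHalf) : HasDerivAt (iteratedDeriv k F) (iteratedDeriv (k + 1) F z) z := by
  have h : ∀ k, DifferentiableOn ℂ (iteratedDeriv k F) upperHalf := by
    intro k
    induction k with
    | zero => simpa using hF
    | succ k ih => rw [iteratedDeriv_succ]; exact ih.deriv isOpen_upperHalf
  rw [iteratedDeriv_succ]
  exact ((h k).differentiableAt (isOpen_upperHalf.mem_nhds hz)).hasDerivAt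

/-- A derivative of size `O(t ^ (-1/2))` is integrable at `0`, so the function has a limit at `0+`,
with an error `O(√y)` whose constant depends only on that of the derivative. -/
lemma exists_tendsto_of_norm_deriv_le {f f' : ℝ → ℂ} {A : ℝ}
    (hf : ∀ t, 0 < t → HasDerivAt f (f' t) t)
    (hf' : ∀ t, 0 < t → ‖f' t‖ ≤ A * t ^ (-(1 / 2) : ℝ)) :
    ∃ L, Tendsto f (𝓝[>] 0) (𝓝 L) ∧ ∀ y, 0 < y → ‖f y - L‖ ≤ 2 * A * Real.sqrt y := by
  have hA : 0 ≤ A := by simpa using (norm_nonneg _).trans (hf' 1 one_pos)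
  have key : ∀ s y, 0 < s → s ≤ y → ‖f y - f s‖ ≤ 2 * A * Real.sqrt y := by
    intro s y hs hsy
    have := image_norm_le_of_norm_deriv_right_le_deriv_boundary' (a := s) (b := y)
      (f := fun t => f t - f s) (f' := f') (B := fun t => 2 * A * (Real.sqrt t - Real.sqrt s))
      (B' := fun t => A * t ^ (-(1 / 2) : ℝ)) ?_ ?_ (by simp) ?_ ?_ ?_ (right_mem_Icc.2 hsy)
    · refine this.trans ?_
      have := Real.sqrt_nonneg s
      gcongr; linarith
    · exact fun t ht => ((hf t (hs.trans_le ht.1)).continuousAt.sub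
          continuousAt_const).continuousWithinAt
    · exact fun t ht => ((hf t (hs.trans_le ht.1)).sub_const _).hasDerivWithinAt
    · fun_prop
    · intro t ht
      have ht0 : 0 < t := hs.trans_le ht.1
      refine HasDerivAt.hasDerivWithinAt ?_
      refine (((Real.hasDerivAt_sqrt ht0.ne').sub_const _).const_mul (2 * A)).congr_deriv ?_
      rw [Real.rpow_neg ht0.le, ← Real.sqrt_eq_rpow]
      field_simp
    · exact fun t ht => hf' t (hs.trans_le ht.1)
  have hs0 : Tendsto (fun y : ℝ => 2 * (2 * A * Real.sqrt y)) (𝓝[>] 0) (𝓝 0) := by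
    have : ContinuousAt (fun y : ℝ => 2 * (2 * A * Real.sqrt y)) 0 := by fun_prop
    simpa using this.tendsto.mono_left nhdsWithin_le_nhds
  have hC : Cauchy (map f (𝓝[>] 0)) := by
    rw [Metric.cauchy_iff]
    refine ⟨inferInstance, fun ε hε => ?_⟩
    obtain ⟨y, hyε, hy⟩ := ((hs0.eventually_lt_const hε).and self_mem_nhdsWithin).exists
    have hy : 0 < y := hy
    refine ⟨f '' Ioc 0 y, image_mem_map (Ioc_mem_nhdsGT hy), ?_⟩
    rintro _ ⟨s, hs, rfl⟩ _ ⟨t, ht, rfl⟩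
    have h1 := key s y hs.1 hs.2
    have h2 := key t y ht.1 ht.2
    rw [dist_eq_norm]
    calc _ = ‖(f y - f t) - (f y - f s)‖ := by congr 1; ring
      _ ≤ _ := norm_sub_le _ _
      _ < ε := by linarith
  obtain ⟨L, hL⟩ := CompleteSpace.complete hC
  have hL : Tendsto f (𝓝[>] 0) (𝓝 L) := hL
  refine ⟨L, hL, fun y hy => ?_⟩
  refine le_of_tendsto ((tendsto_const_nhds.sub hL).norm) ?_
  filter_upwards [Ioc_mem_nhdsGT hy] with s hs
  exact key s y hs.1 hs.2

variable {n : ℕ} {F : ℂ → ℂ}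

lemma mem_upperHalf_line {y : ℝ} (hy : 0 < y) (x : ℝ) : (x : ℂ) + y * I ∈ upperHalf := by
  simpa [mem_upperHalf] using hy

lemma hasDerivAt_vertical {f : ℂ → ℂ} {f' : ℂ} {x y : ℝ} (hf : HasDerivAt f f' (x + y * I)) :
    HasDerivAt (fun t : ℝ => f (x + t * I)) (I * f') y := by
  have h1 : HasDerivAt (fun t : ℝ => (x : ℂ) + t * I) I y := by
    simpa using ((Complex.ofRealCLM.hasDerivAt (x := y)).mul_const I).const_add (x : ℂ)
  have := hf.comp_of_eq y h1 rfl
  rwa [mul_comm] at this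

lemma hasDerivAt_horizontal {f : ℂ → ℂ} {f' : ℂ} {x y : ℝ} (hf : HasDerivAt f f' (x + y * I)) :
    HasDerivAt (fun t : ℝ => f (t + y * I)) f' x := by
  have h1 : HasDerivAt (fun t : ℝ => (t : ℂ) + y * I) 1 x := by
    simpa using (Complex.ofRealCLM.hasDerivAt (x := x)).add_const (y * I)
  have := hf.comp_of_eq x h1 rfl
  rwa [mul_one] at this

/-- Vertical limits of `F⁽ᵏ⁾` exist off the origin for `k < n`,
    with an error that is locally uniform
in `x`: by the growth of the Hardy function `z ^ (k + 1) * F⁽ᵏ⁺¹⁾(z)`, the vertical derivative of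
`F⁽ᵏ⁾` is `O(|x| ^ (-(k + 1)) * y ^ (-1/2))`. -/
lemma exists_boundary_bound (hF : F ∈ hardySobolev n) {k : ℕ} (hk : k < n) :
    ∃ C : ℝ, 0 ≤ C ∧ ∀ x : ℝ, x ≠ 0 →
      Tendsto (fun y : ℝ => iteratedDeriv k F (x + y * I)) (𝓝[>] 0)
        (𝓝 (boundary (iteratedDeriv k F) x)) ∧
      ∀ y : ℝ, 0 < y → ‖iteratedDeriv k F (x + y * I) - boundary (iteratedDeriv k F) x‖ ≤
        C / |x| ^ (k + 1) * Real.sqrt y := by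
  obtain ⟨C, hC0, hC⟩ := hardy_exists_norm_le (hF.2 (k + 1) hk)
  refine ⟨2 * C, by positivity, fun x hx => ?_⟩
  have hx' : 0 < |x| := abs_pos.2 hx
  obtain ⟨L, hL, hL'⟩ := exists_tendsto_of_norm_deriv_le (A := C / |x| ^ (k + 1))
    (f := fun y : ℝ => iteratedDeriv k F (x + y * I))
    (fun y hy => hasDerivAt_vertical (hasDerivAt_iteratedDeriv hF.1 k (mem_upperHalf_line hy x)))
    (fun y hy => by
      have h1 := hC _ (mem_upperHalf_line hy x)
      rw [norm_mul, norm_I, one_mul, div_mul_eq_mul_div, le_div_iff₀ (by positivity), mul_comm]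
      have him : ((x : ℂ) + y * I).im = y := by simp
      rw [norm_mul, norm_pow, him] at h1
      refine le_trans ?_ h1
      gcongr
      simpa using abs_re_le_norm ((x : ℂ) + y * I))
  have hLeq : boundary (iteratedDeriv k F) x = L := hL.limUnder_eq
  rw [hLeq]
  refine ⟨hL, fun y hy => (hL' y hy).trans (le_of_eq ?_)⟩
  ring

lemma tendsto_boundary (hF : F ∈ hardySobolev n) {k : ℕ} (hk : k < n) {x : ℝ} (hx : x ≠ 0) :
    Tendsto (fun y : ℝ => iteratedDeriv k F (x + y * I)) (𝓝[>] 0)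
        (𝓝 (boundary (iteratedDeriv k F) x)) := by
  obtain ⟨C, -, h⟩ := exists_boundary_bound hF hk
  exact (h x hx).1

lemma tendstoLocallyUniformlyOn_boundary (hF : F ∈ hardySobolev n) {k : ℕ} (hk : k < n) :
    TendstoLocallyUniformlyOn (fun (y x : ℝ) => iteratedDeriv k F (x + y * I))
      (boundary (iteratedDeriv k F)) (𝓝[>] 0) {0}ᶜ := by
  obtain ⟨C, hC0, hC⟩ := exists_boundary_bound hF hk
  rw [Metric.tendstoLocallyUniformlyOn_iff]
  intro ε hε x hx
  have hx' : 0 < |x| := abs_pos.2 hx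
  refine ⟨{u : ℝ | |x| / 2 < |u|}, mem_nhdsWithin_of_mem_nhds
    ((isOpen_lt continuous_const continuous_abs).mem_nhds
        (by simp only [mem_ofPred_eq]; linarith)), ?_⟩
  have ht : Tendsto (fun y : ℝ => C / (|x| / 2) ^ (k + 1) * Real.sqrt y) (𝓝[>] 0) (𝓝 0) := by
    have : ContinuousAt (fun y : ℝ => C / (|x| / 2) ^ (k + 1) * Real.sqrt y) 0 := by fun_prop
    simpa using this.tendsto.mono_left nhdsWithin_le_nhds
  filter_upwards [ht.eventually_lt_const hε, self_mem_nhdsWithin] with y hy hy0 u hu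
  have hu : |x| / 2 < |u| := hu
  have hu0 : u ≠ 0 := by rintro rfl; simp at hu; linarith
  rw [dist_comm, dist_eq_norm]
  refine ((hC u hu0).2 y hy0).trans_lt (lt_of_le_of_lt ?_ hy)
  gcongr

lemma continuousOn_boundary (hF : F ∈ hardySobolev n) {k : ℕ} (hk : k < n) :
    ContinuousOn (boundary (iteratedDeriv k F)) {0}ᶜ := by
  refine (tendstoLocallyUniformlyOn_boundary hF hk).continuousOn (Eventually.frequently ?_)
  filter_upwards [self_mem_nhdsWithin] with y hy
  exact fun x _ => (hasDerivAt_horizontal (hasDerivAt_iteratedDeriv hF.1 k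
    (mem_upperHalf_line hy x))).continuousAt.continuousWithinAt

lemma hasDerivAt_boundary (hF : F ∈ hardySobolev n) {k : ℕ} (hk : k + 1 < n) {x : ℝ} (hx : x ≠ 0) :
    HasDerivAt (boundary (iteratedDeriv k F)) (boundary (iteratedDeriv (k + 1) F) x) x := by
  refine hasDerivAt_of_tendstoLocallyUniformlyOn isOpen_compl_singleton
    (tendstoLocallyUniformlyOn_boundary hF hk) (f := fun (y x : ℝ) => iteratedDeriv k F (x + y * I))
    ?_ (fun u hu => tendsto_boundary hF (by omega) hu) hx
  filter_upwards [self_mem_nhdsWithin] with y hy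
  exact fun x _ => hasDerivAt_horizontal (hasDerivAt_iteratedDeriv hF.1 k (mem_upperHalf_line hy x))

/-- Below the top order, differentiation commutes with passing to the boundary. -/
lemma iteratedDeriv_boundary (hF : F ∈ hardySobolev n) {k : ℕ} (hk : k < n) {x : ℝ} (hx : x ≠ 0) :
    iteratedDeriv k (boundary F) x = boundary (iteratedDeriv k F) x := by
  induction k generalizing x with
  | zero => simp
  | succ k ih =>
    have h1 : iteratedDeriv k (boundary F) =ᶠ[𝓝 x] boundary (iteratedDeriv k F) := by
      filter_upwards [isOpen_compl_singleton.mem_nhds hx] with u hu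
      exact ih (by omega) hu
    rw [iteratedDeriv_succ, h1.deriv_eq, (hasDerivAt_boundary hF hk hx).deriv]

lemma tendsto_pow_mul_boundary {m : ℕ} (hF : F ∈ hardySobolev (m + 1)) (j : ℕ) {x : ℝ}
    (hx : x ≠ 0) :
    Tendsto (fun y : ℝ => ((x : ℂ) + y * I) ^ j * iteratedDeriv m F (x + y * I)) (𝓝[>] 0)
      (𝓝 ((x : ℂ) ^ j * boundary (iteratedDeriv m F) x)) := by
  have hline : Tendsto (fun y : ℝ => (x : ℂ) + y * I) (𝓝[>] 0) (𝓝 x) := by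
    have : ContinuousAt (fun y : ℝ => (x : ℂ) + y * I) 0 := by fun_prop
    simpa using this.tendsto.mono_left nhdsWithin_le_nhds
  exact (hline.pow j).mul (tendsto_boundary hF (Nat.lt_succ_self m) hx)

lemma continuous_iteratedDeriv_line (hF : DifferentiableOn ℂ F upperHalf) (k : ℕ) {y : ℝ}
    (hy : 0 < y) :
    Continuous fun t : ℝ => iteratedDeriv k F (t + y * I) :=
  continuous_iff_continuousAt.2 fun x => (hasDerivAt_horizontal (hasDerivAt_iteratedDeriv hF k
        (mem_upperHalf_line hy x))).continuousAt

lemma continuous_pow_mul_iteratedDeriv_line (hF : DifferentiableOn ℂ F upperHalf) (j k : ℕ) {y : ℝ}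
    (hy : 0 < y) :
    Continuous fun t : ℝ => ((t : ℂ) + y * I) ^ j * iteratedDeriv k F (t + y * I) := by
  have := continuous_iteratedDeriv_line hF k hy
  fun_prop

lemma tendsto_integral_pow_mul_boundary {m : ℕ} (hF : F ∈ hardySobolev (m + 1)) {a b : ℝ}
    (hne : ∀ t ∈ uIcc a b, t ≠ 0) :
    Tendsto (fun y : ℝ => ∫ t in a..b, ((t : ℂ) + y * I) ^ m *
      iteratedDeriv m F (t + y * I)) (𝓝[>] 0)
      (𝓝 (∫ t in a..b, (t : ℂ) ^ m * boundary (iteratedDeriv m F) t)) := by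
  obtain ⟨C, hC0, hC⟩ := exists_boundary_bound hF (Nat.lt_succ_self m)
  refine intervalIntegral.tendsto_integral_filter_of_dominated_convergence
    (fun t => (|t| + 1) ^ m * (‖boundary (iteratedDeriv m F) t‖ + C / |t| ^ (m + 1))) ?_ ?_ ?_ ?_
  · filter_upwards [self_mem_nhdsWithin] with y hy
    exact (continuous_pow_mul_iteratedDeriv_line hF.1 m m hy).aestronglyMeasurable
  · filter_upwards [Ioc_mem_nhdsGT one_pos] with y hy
    refine Eventually.of_forall fun t ht => ?_
    have ht0 := hne t (uIoc_subset_uIcc ht)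
    have h1 := (hC t ht0).2 y hy.1
    have hs : Real.sqrt y ≤ 1 := Real.sqrt_le_one.2 hy.2
    have h2 : ‖(t : ℂ) + y * I‖ ≤ |t| + 1 := by
      refine (norm_add_le _ _).trans ?_
      simp [abs_of_pos hy.1, hy.2]
    have h3 : ‖iteratedDeriv m F (t + y * I)‖ ≤
        ‖boundary (iteratedDeriv m F) t‖ + C / |t| ^ (m + 1) := by
      have h4 := norm_sub_norm_le (iteratedDeriv m F (t + y * I)) (boundary (iteratedDeriv m F) t)
      have h5 : C / |t| ^ (m + 1) * Real.sqrt y ≤ C / |t| ^ (m + 1) * 1 := by gcongr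
      linarith
    rw [norm_mul, norm_pow]
    gcongr
  · refine ContinuousOn.intervalIntegrable ?_
    have h1 : ContinuousOn (fun t : ℝ => (|t| + 1) ^ m) (uIcc a b) := by fun_prop
    refine h1.mul (((continuousOn_boundary hF (Nat.lt_succ_self m)).mono hne).norm.add
      (continuousOn_const.div (by fun_prop) fun t ht => ?_))
    have := abs_pos.2 (hne t ht); positivity
  · refine Eventually.of_forall fun t ht => ?_
    exact tendsto_pow_mul_boundary hF m (hne t (uIoc_subset_uIcc ht))

/-- The fundamental theorem of calculus for `z ^ (m + 1) * F⁽ᵐ⁾(z)` on a horizontal segment. -/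
lemma slice_sub_eq_integral (hF : DifferentiableOn ℂ F upperHalf) (m : ℕ) {y : ℝ} (hy : 0 < y)
    (a b : ℝ) :
    ((b : ℂ) + y * I) ^ (m + 1) * iteratedDeriv m F (b + y * I) -
      ((a : ℂ) + y * I) ^ (m + 1) * iteratedDeriv m F (a + y * I) =
      (∫ t in a..b, ((m : ℂ) + 1) * (((t : ℂ) + y * I) ^ m * iteratedDeriv m F (t + y * I))) +
        ∫ t in a..b, ((t : ℂ) + y * I) ^ (m + 1) * iteratedDeriv (m + 1) F (t + y * I) := by
  have c1 : Continuous fun t : ℝ => ((m : ℂ) + 1) *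
      (((t : ℂ) + y * I) ^ m * iteratedDeriv m F (t + y * I)) :=
    continuous_const.mul (continuous_pow_mul_iteratedDeriv_line hF m m hy)
  have c2 := continuous_pow_mul_iteratedDeriv_line hF (m + 1) (m + 1) hy
  rw [← intervalIntegral.integral_add (c1.intervalIntegrable _ _) (c2.intervalIntegrable _ _)]
  refine (intervalIntegral.integral_eq_sub_of_hasDerivAt
    (f := fun t : ℝ => ((t : ℂ) + y * I) ^ (m + 1) * iteratedDeriv m F (t + y * I)) (fun t _ => ?_)
    ((c1.add c2).intervalIntegrable _ _)).symm
  have h1 : HasDerivAt (fun z : ℂ => z ^ (m + 1) * iteratedDeriv m F z)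
      (((m : ℂ) + 1) * (((t : ℂ) + y * I) ^ m * iteratedDeriv m F (t + y * I)) +
        ((t : ℂ) + y * I) ^ (m + 1) * iteratedDeriv (m + 1) F (t + y * I)) (t + y * I) := by
    refine ((hasDerivAt_pow (m + 1) _).mul
      (hasDerivAt_iteratedDeriv hF m (mem_upperHalf_line hy t))).congr_deriv ?_
    push_cast; simp; ring
  exact hasDerivAt_horizontal h1

/-- The limit of `slice_sub_eq_integral` on the real line. Only the last term needs weak
convergence, and it is tested against an indicator function; this is why the product
`z ^ (m + 1) * F⁽ᵐ⁾(z)` is differentiated rather than `F⁽ᵐ⁾`. -/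
lemma boundary_sub_eq_integral {m : ℕ} (hF : F ∈ hardySobolev (m + 1)) {U : Ultrafilter ℝ} {g : ℝ →
    ℂ}
    (hg : IsWeakBoundary (fun z => z ^ (m + 1) * iteratedDeriv (m + 1) F z) U g)
    {a b : ℝ} (hab : (0 : ℝ) ∉ uIcc a b) :
    (b : ℂ) ^ (m + 1) * boundary (iteratedDeriv m F) b - (a : ℂ) ^ (m + 1) * boundary
        (iteratedDeriv m F) a =
      (∫ t in a..b, (m + 1) * ((t : ℂ) ^ m * boundary (iteratedDeriv m F) t)) + ∫ t in a..b, g t := by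
  have hne : ∀ t ∈ uIcc a b, t ≠ 0 := fun t ht h => hab (h ▸ ht)
  have T1 : Tendsto (fun y : ℝ => ∫ t in a..b, ((m : ℂ) + 1) * (((t : ℂ) + y * I) ^ m *
      iteratedDeriv m F (t + y * I))) (𝓝[>] 0)
      (𝓝 (∫ t in a..b, ((m : ℂ) + 1) * ((t : ℂ) ^ m * boundary (iteratedDeriv m F) t))) := by
    simp only [intervalIntegral.integral_const_mul]
    exact (tendsto_integral_pow_mul_boundary hF hne).const_mul _
  have T2 := hg.tendsto_intervalIntegral a b
  have T3 := (tendsto_pow_mul_boundary hF (m + 1) (hne b right_mem_uIcc)).sub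
    (tendsto_pow_mul_boundary hF (m + 1) (hne a left_mem_uIcc))
  refine tendsto_nhds_unique (T3.mono_left hg.le_nhdsGT)
      (((T1.mono_left hg.le_nhdsGT).add T2).congr' ?_)
  filter_upwards [hg.le_nhdsGT self_mem_nhdsWithin] with y hy
  exact (slice_sub_eq_integral hF.1 m hy a b).symm

/-- At the top order the boundary function of `F⁽ᵐ⁾` is differentiable almost everywhere, by
Lebesgue's differentiation theorem, and its derivative is read off from the weak boundary function
of `z ^ (m + 1) * F⁽ᵐ⁺¹⁾(z)`. -/
lemma ae_hasDerivAt_boundary {m : ℕ} (hF : F ∈ hardySobolev (m + 1)) {U : Ultrafilter ℝ} {g : ℝ → ℂ}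
    (hg : IsWeakBoundary (fun z => z ^ (m + 1) * iteratedDeriv (m + 1) F z) U g) :
    ∀ᵐ x : ℝ, x ≠ 0 ∧ HasDerivAt (boundary (iteratedDeriv m F)) (g x / (x : ℂ) ^ (m + 1)) x := by
  have hloc : LocallyIntegrable g := hg.memLp.locallyIntegrable (by norm_num)
  have hx0 : ∀ᵐ x : ℝ, x ≠ 0 := by simp [ae_iff, measure_singleton]
  filter_upwards [hx0, _root_.LocallyIntegrable.ae_hasDerivAt_integral hloc] with x hx hdx
  refine ⟨hx, ?_⟩
  have hxC : (x : ℂ) ≠ 0 := by exact_mod_cast hx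
  have hnot : ∀ u : ℝ, 0 < x * u → (0 : ℝ) ∉ uIcc x u := by
    intro u hu h0
    rw [mem_uIcc] at h0
    rcases h0 with ⟨h1, h2⟩ | ⟨h1, h2⟩ <;> nlinarith
  set B := boundary (iteratedDeriv m F) with hB
  have hBc : ContinuousOn B {0}ᶜ := continuousOn_boundary hF (Nat.lt_succ_self m)
  have hpc : ContinuousOn (fun t : ℝ => (t : ℂ) ^ m) {0}ᶜ := by fun_prop
  have hψc : ContinuousOn (fun t : ℝ => ((m : ℂ) + 1) * ((t : ℂ) ^ m * B t)) {0}ᶜ :=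
    continuousOn_const.mul (hpc.mul hBc)
  have hd1 : HasDerivAt (fun u => ∫ t in x..u, ((m : ℂ) + 1) * ((t : ℂ) ^ m * B t))
      (((m : ℂ) + 1) * ((x : ℂ) ^ m * B x)) x :=
    intervalIntegral.integral_hasDerivAt_right (by simp)
      (hψc.stronglyMeasurableAtFilter isOpen_compl_singleton x hx)
      (hψc.continuousAt (isOpen_compl_singleton.mem_nhds hx))
  have hd2 := ((hd1.add (hdx x)).add_const ((x : ℂ) ^ (m + 1) * B x)).div
    ((Complex.ofRealCLM.hasDerivAt (x := x)).pow (m + 1)) (by simpa using hx)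
  refine (hd2.congr_of_eventuallyEq ?_).congr_deriv ?_
  · have : {u : ℝ | 0 < x * u} ∈ 𝓝 x :=
      (isOpen_lt continuous_const (by fun_prop)).mem_nhds (mul_self_pos.2 hx)
    filter_upwards [this] with u hu
    have hu0 : (u : ℂ) ≠ 0 := by
      have : u ≠ 0 := by rintro rfl; simp at hu
      exact_mod_cast this
    have := boundary_sub_eq_integral hF hg (hnot u hu)
    simp only [Pi.div_apply, Pi.add_apply, Pi.pow_apply, ofRealCLM_apply]
    rw [eq_div_iff (pow_ne_zero _ hu0)]
    linear_combination this
  · simp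
    field_simp
    ring

end

/-! ### Taylor's formula along a ray to infinity -/

section

variable {F : ℂ → ℂ} {w : ℂ}

lemma div_ofReal_mem_upperHalf (hw : w ∈ upperHalf) {y : ℝ} (hy : 0 < y) : w / y ∈ upperHalf := by
  rw [mem_upperHalf, Complex.div_ofReal_im]; exact div_pos hw hy

lemma hasDerivAt_pow_mul_iteratedDeriv_div (hF : DifferentiableOn ℂ F upperHalf)
    (hw : w ∈ upperHalf)
    (k : ℕ) {y : ℝ} (hy : 0 < y) :
    HasDerivAt (fun y : ℝ => (w / y) ^ k * iteratedDeriv k F (w / y))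
      (-(y : ℂ)⁻¹ * (k * ((w / y) ^ k * iteratedDeriv k F (w / y)) +
        (w / y) ^ (k + 1) * iteratedDeriv (k + 1) F (w / y))) y := by
  have hyC : (y : ℂ) ≠ 0 := by exact_mod_cast hy.ne'
  have h1 : HasDerivAt (fun y : ℝ => w / y) (-(y : ℂ)⁻¹ * (w / y)) y := by
    refine (((Complex.ofRealCLM.hasDerivAt (x := y)).fun_inv (by simpa using hyC)).const_mul
        w).congr_deriv ?_
    simp; field_simp
  have h2 : HasDerivAt (iteratedDeriv k F) (iteratedDeriv (k + 1) F (w / y)) (w / y) :=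
    hasDerivAt_iteratedDeriv hF k (div_ofReal_mem_upperHalf hw hy)
  refine ((h1.pow k).mul (h2.comp_of_eq y h1 rfl)).congr_deriv ?_
  rcases k with _ | k
  · simp; ring
  · simp; ring

/-- The derivative of the Taylor sum of `F` at `w / y`, evaluated at `w`, telescopes to the top
term. -/
lemma hasDerivAt_taylor_sum (hF : DifferentiableOn ℂ F upperHalf) (hw : w ∈ upperHalf)
    (m : ℕ) {y : ℝ} (hy : 0 < y) :
    HasDerivAt (fun y : ℝ => ∑ k ∈ Finset.range (m + 1), (-1 : ℂ) ^ k / k.factorial *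
        (1 - (y : ℂ)) ^ k * ((w / y) ^ k * iteratedDeriv k F (w / y)))
      (-((-1 : ℂ) ^ m / m.factorial * ((1 - (y : ℂ)) ^ m * ((y : ℂ)⁻¹ *
        ((w / y) ^ (m + 1) * iteratedDeriv (m + 1) F (w / y)))))) y := by
  have hyC : (y : ℂ) ≠ 0 := by exact_mod_cast hy.ne'
  have hs : HasDerivAt (fun y : ℝ => 1 - (y : ℂ)) (-1) y := by
    simpa using (Complex.ofRealCLM.hasDerivAt (x := y)).const_sub 1
  induction m with
  | zero =>
    simp only [zero_add, Finset.range_one, Finset.sum_singleton]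
    refine ((hasDerivAt_pow_mul_iteratedDeriv_div hF hw 0 hy).const_mul
      ((-1 : ℂ) ^ 0 / (Nat.factorial 0 : ℂ))).congr_deriv ?_ |>.congr_of_eventuallyEq ?_
    · simp
    · exact Eventually.of_forall fun u => by simp
  | succ m ih =>
    simp only [Finset.sum_range_succ _ (m + 1)]
    refine (ih.add (((hs.pow (m + 1)).const_mul ((-1 : ℂ) ^ (m + 1) / (m + 1).factorial)).mul
      (hasDerivAt_pow_mul_iteratedDeriv_div hF hw (m + 1) hy))).congr_deriv ?_
    have : ((m.factorial : ℕ) : ℂ) ≠ 0 := by exact_mod_cast m.factorial_ne_zero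
    have h2 : (m : ℂ) + 1 ≠ 0 := by exact_mod_cast m.succ_ne_zero
    simp only [Nat.factorial_succ, Pi.pow_apply]
    push_cast
    generalize (w / (y : ℂ)) ^ (m + 1) * iteratedDeriv (m + 1) F (w / y) = a
    generalize (w / (y : ℂ)) ^ (m + 1 + 1) * iteratedDeriv (m + 1 + 1) F (w / y) = b
    field_simp
    ring

/-- Decay of `z ^ k * F⁽ᵏ⁾(z)` as `z = w / y` tends to infinity along a ray. -/
lemma exists_norm_pow_mul_div_le {n : ℕ} (hF : F ∈ hardySobolev n) (hw : w ∈ upperHalf) {k : ℕ}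
    (hk : k ≤ n) :
    ∃ C : ℝ, 0 ≤ C ∧ ∀ y : ℝ, 0 < y →
      ‖(w / y) ^ k * iteratedDeriv k F (w / y)‖ ≤ C * y ^ (1 / 2 : ℝ) := by
  obtain ⟨C, hC0, hC⟩ := hardy_exists_norm_le (hF.2 k hk)
  have hw' : 0 < w.im := hw
  refine ⟨C * w.im ^ (-(1 / 2) : ℝ), by positivity, fun y hy => ?_⟩
  refine (hC _ (div_ofReal_mem_upperHalf hw hy)).trans (le_of_eq ?_)
  rw [Complex.div_ofReal_im, Real.div_rpow hw'.le hy.le, Real.rpow_neg hy.le, div_inv_eq_mul,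
      mul_assoc]

/-- Taylor's formula with integral remainder along the ray from `w` to infinity, parametrized by
`w / y` with `0 < y ≤ 1`. The Taylor sum is `F w` at `y = 1` and vanishes as `y → 0+`. -/
lemma taylor_integral {m : ℕ} (hF : F ∈ hardySobolev (m + 1)) (hw : w ∈ upperHalf) :
    F w = (-1 : ℂ) ^ (m + 1) / m.factorial * ∫ y in (0 : ℝ)..1, (1 - (y : ℂ)) ^ m * ((y : ℂ)⁻¹ *
        ((w / y) ^ (m + 1) * iteratedDeriv (m + 1) F (w / y))) := by
  set φ : ℝ → ℂ := fun y => (1 - (y : ℂ)) ^ m * ((y : ℂ)⁻¹ *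
        ((w / y) ^ (m + 1) * iteratedDeriv (m + 1) F (w / y))) with hφ
  have hint : IntervalIntegrable φ volume 0 1 := by
    obtain ⟨C, hC0, hC⟩ := exists_norm_pow_mul_div_le hF hw le_rfl
    have hb : IntervalIntegrable (fun y : ℝ => C * y ^ (-(1 / 2) : ℝ)) volume 0 1 :=
      (intervalIntegral.intervalIntegrable_rpow' (by norm_num)).const_mul C
    refine hb.mono_fun' ?_ ?_
    · rw [uIoc_of_le zero_le_one]
      refine ContinuousOn.aestronglyMeasurable (fun y hy => ?_) measurableSet_Ioc
      have hy0 : (y : ℂ) ≠ 0 := by exact_mod_cast hy.1.ne'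
      refine ContinuousAt.continuousWithinAt ?_
      have := (hasDerivAt_pow_mul_iteratedDeriv_div hF.1 hw (m + 1) hy.1).continuousAt
      have h2 : ContinuousAt (fun y : ℝ => (y : ℂ)⁻¹) y := ContinuousAt.inv₀ (by fun_prop) hy0
      have h3 : ContinuousAt (fun y : ℝ => (1 - (y : ℂ)) ^ m) y := by fun_prop
      exact h3.mul (h2.mul this)
    · rw [uIoc_of_le zero_le_one]
      refine (ae_restrict_iff' measurableSet_Ioc).2 (Eventually.of_forall fun y hy => ?_)
      have hy0 := hy.1
      have e1 : ‖(1 - (y : ℂ)) ^ m‖ ≤ 1 := by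
        rw [norm_pow, show (1 - (y : ℂ)) = ((1 - y : ℝ) : ℂ) by push_cast; ring, Complex.norm_real]
        refine pow_le_one₀ (norm_nonneg _) ?_
        rw [Real.norm_eq_abs, abs_le]; constructor <;> linarith [hy.2]
      simp only [hφ]
      rw [norm_mul, norm_mul, norm_inv, Complex.norm_real, Real.norm_of_nonneg hy0.le]
      calc _ ≤ 1 * (y⁻¹ * (C * y ^ (1 / 2 : ℝ))) := by gcongr; exact hC y hy0
        _ = C * (y ^ (-1 : ℝ) * y ^ (1 / 2 : ℝ)) := by rw [Real.rpow_neg_one]; ring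
        _ = _ := by rw [← Real.rpow_add hy0]; norm_num
  have hd : ∀ y ∈ Ioo (0 : ℝ) 1, _ := fun y hy => hasDerivAt_taylor_sum hF.1 hw m hy.1
  have key := intervalIntegral.integral_eq_sub_of_hasDerivAt_of_tendsto zero_lt_one hd
    ((hint.const_mul ((-1 : ℂ) ^ m / m.factorial)).neg) (fa := 0) (fb := F w) ?_ ?_
  · rw [intervalIntegral.integral_neg, intervalIntegral.integral_const_mul] at key
    rw [pow_succ]
    linear_combination -key
  · rw [show (0 : ℂ) = ∑ _k ∈ Finset.range (m + 1), 0 by simp]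
    refine tendsto_finsetSum _ fun k hk => ?_
    obtain ⟨C, hC0, hC⟩ := exists_norm_pow_mul_div_le hF hw (Finset.mem_range.1 hk).le
    have h1 : Tendsto (fun y : ℝ => (w / y) ^ k * iteratedDeriv k F (w / y)) (𝓝[>] 0) (𝓝 0) := by
      refine squeeze_zero_norm' (a := fun y : ℝ => C * y ^ (1 / 2 : ℝ)) ?_ ?_
      · filter_upwards [self_mem_nhdsWithin] with y hy using hC y hy
      · have : ContinuousAt (fun y : ℝ => C * y ^ (1 / 2 : ℝ)) 0 :=
          continuousAt_const.mul (Real.continuousAt_rpow_const _ _ (by norm_num))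
        have := this.tendsto.mono_left (nhdsWithin_le_nhds (s := Ioi 0))
        simpa [Real.zero_rpow] using this
    have h2 : ContinuousAt (fun y : ℝ => (-1 : ℂ) ^ k / k.factorial * (1 - (y : ℂ)) ^ k) 0 :=
        by fun_prop
    simpa using (h2.tendsto.mono_left (nhdsWithin_le_nhds (s := Ioi 0))).mul h1
  · have h1 := (hasDerivAt_taylor_sum hF.1 hw m one_pos).continuousAt.tendsto.mono_left
      (nhdsWithin_le_nhds (s := Iio 1))
    convert h1 using 2
    rw [Finset.sum_range_succ']
    simp

end

/-! ### The kernel and its derivatives -/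

/-- The envelope `min (|x| ^ (-1/4)) (|x| ^ (-3/4))`, a square integrable function on the line. -/
noncomputable def envelope (x : ℝ) : ℝ := min (|x| ^ (-(1 / 4) : ℝ)) (|x| ^ (-(3 / 4) : ℝ))

lemma envelope_nonneg (x : ℝ) : 0 ≤ envelope x := le_min (by positivity) (by positivity)

lemma measurable_envelope : Measurable envelope := by unfold envelope; fun_prop

lemma memLp_envelope : MemLp envelope 2 := by
  rw [memLp_two_iff_integrable_sq measurable_envelope.aestronglyMeasurable]
  have hm : Measurable fun x => envelope x ^ 2 := measurable_envelope.pow_const 2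
  have hsq : ∀ x s : ℝ, 0 < x → (x ^ s) ^ 2 = x ^ (s * 2) := fun x s hx => by
    rw [Real.rpow_mul hx.le, Real.rpow_two]
  have h1 : IntegrableOn (fun x => envelope x ^ 2) (Ioi 0) := by
    rw [← Ioc_union_Ioi_eq_Ioi zero_le_one, integrableOn_union]
    constructor
    · have : IntegrableOn (fun x : ℝ => x ^ (-(1 / 2) : ℝ)) (Ioc 0 1) :=
        (intervalIntegrable_iff_integrableOn_Ioc_of_le zero_le_one).1
          (intervalIntegral.intervalIntegrable_rpow' (by norm_num))
      refine Integrable.mono' this hm.aestronglyMeasurable ?_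
      refine (ae_restrict_iff' measurableSet_Ioc).2 (Eventually.of_forall fun x hx => ?_)
      rw [Real.norm_of_nonneg (sq_nonneg _)]
      refine (pow_le_pow_left₀ (envelope_nonneg x) (min_le_left _ _) 2).trans (le_of_eq ?_)
      rw [abs_of_pos hx.1, hsq _ _ hx.1]; norm_num
    · have : IntegrableOn (fun x : ℝ => x ^ (-(3 / 2) : ℝ)) (Ioi 1) :=
        integrableOn_Ioi_rpow_of_lt (by norm_num) one_pos
      refine Integrable.mono' this hm.aestronglyMeasurable ?_
      refine (ae_restrict_iff' measurableSet_Ioi).2 (Eventually.of_forall fun x hx => ?_)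
      have hx : 0 < x := one_pos.trans hx
      rw [Real.norm_of_nonneg (sq_nonneg _)]
      refine (pow_le_pow_left₀ (envelope_nonneg x) (min_le_right _ _) 2).trans (le_of_eq ?_)
      rw [abs_of_pos hx, hsq _ _ hx]; norm_num
  have h2 : IntegrableOn (fun x => envelope x ^ 2) (Iic 0) := by
    have := h1.comp_neg
    rw [integrableOn_Iic_iff_integrableOn_Iio]
    simpa [envelope] using this
  rw [← integrableOn_univ, ← Iic_union_Ioi (a := (0 : ℝ))]
  exact h2.union h1

/-- The bound with exponent `1/4` makes `|f| ^ 2` integrable near the origin, and the one with `3/4`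
near infinity, uniformly over horizontal lines. -/
lemma mem_hardy_of_norm_le {f : ℂ → ℂ} (hd : DifferentiableOn ℂ f upperHalf) {C : ℝ}
    (h : ∀ z ∈ upperHalf, ∀ s ∈ ({1 / 4, 3 / 4} : Set ℝ), ‖f z‖ ≤ C * ‖z‖ ^ (-s)) : f ∈ hardy := by
  refine ⟨hd, ?_⟩
  have hC0 : 0 ≤ C := by
    have := (norm_nonneg _).trans (h I (by simp [mem_upperHalf]) (1 / 4) (by simp))
    simpa using this
  have hfin : ∫⁻ x : ℝ, ENNReal.ofReal (C * envelope x) ^ 2 < ⊤ := by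
    have := (memLp_envelope.const_mul C).2
    rw [eLpNorm_lt_top_iff_lintegral_rpow_enorm_lt_top (by norm_num) (by norm_num)] at this
    refine lt_of_le_of_lt (lintegral_mono fun x => ?_) this
    rw [Real.enorm_of_nonneg (mul_nonneg hC0 (envelope_nonneg x))]
    simp
  refine lt_of_le_of_lt (b := (ENNReal.ofReal (2 * Real.pi))⁻¹ *
    ∫⁻ x : ℝ, ENNReal.ofReal (C * envelope x) ^ 2) (iSup₂_le fun y hy => ?_) ?_
  · gcongr 1
    have hx0 : ∀ᵐ x : ℝ, x ≠ 0 := by simp [ae_iff, measure_singleton]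
    refine lintegral_mono_ae ?_
    filter_upwards [hx0] with x hx
    gcongr
    rw [← ofReal_norm]
    refine ENNReal.ofReal_le_ofReal ?_
    have hx' : 0 < |x| := abs_pos.2 hx
    have hz := mem_upperHalf_line hy x
    have hxz : |x| ≤ ‖(x : ℂ) + y * I‖ := by simpa using abs_re_le_norm ((x : ℂ) + y * I)
    rw [envelope, mul_min_of_nonneg _ _ hC0]
    refine le_min ((h _ hz (1 / 4) (by simp)).trans ?_) ((h _ hz (3 / 4) (by simp)).trans ?_)
    all_goals
      gcongr ?_ * ?_
      exact Real.rpow_le_rpow_of_nonpos hx' hxz (by norm_num)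
  · exact ENNReal.mul_lt_top (by simp [Real.pi_pos]) hfin

/-- The constant `c` in `|y z - x conj w| ≥ c (y |z| + x |w|)` for `Im z ≥ 0` and `x, y ≥ 0`. -/
noncomputable def aperture (w : ℂ) : ℝ := w.im / (w.im + 2 * ‖w‖)

lemma aperture_pos {w : ℂ} (hw : w ∈ upperHalf) : 0 < aperture w := by
  have hw' : 0 < w.im := hw
  unfold aperture; positivity

/-- The imaginary part controls `x |w|`, and the triangle inequality then controls `y |z|`. -/
lemma aperture_mul_le {w z : ℂ} (hw : w ∈ upperHalf) (hz : 0 ≤ z.im) {x y : ℝ} (hx : 0 ≤ x)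
    (hy : 0 ≤ y) :
    aperture w * (y * ‖z‖ + x * ‖w‖) ≤ ‖(y : ℂ) * z - x * (starRingEnd ℂ) w‖ := by
  have hw' : 0 < w.im := hw
  set D := ‖(y : ℂ) * z - x * (starRingEnd ℂ) w‖ with hD
  have h1 : x * w.im ≤ D := by
    refine le_trans ?_ (abs_im_le_norm _)
    refine le_trans ?_ (le_abs_self _)
    simp; positivity
  have h2 : y * ‖z‖ - x * ‖w‖ ≤ D := by
    have := norm_sub_norm_le ((y : ℂ) * z) (x * (starRingEnd ℂ) w)
    simpa [abs_of_nonneg hx, abs_of_nonneg hy] using this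
  unfold aperture
  rw [div_mul_eq_mul_div, div_le_iff₀ (by positivity)]
  nlinarith [mul_le_mul_of_nonneg_right h1 (norm_nonneg w), mul_le_mul_of_nonneg_left h2 hw'.le]

/-- An open neighbourhood, invariant under dilations, of the closed upper half-plane without the
origin. The integral in `kernel n · w` is holomorphic there. -/
noncomputable def sector (w : ℂ) : Set ℂ :=
    {z | ∃ z₀ : ℂ, 0 ≤ z₀.im ∧ ‖z - z₀‖ < aperture w / 2 * ‖z₀‖}

lemma isOpen_sector (w : ℂ) : IsOpen (sector w) := by
  have : sector w = ⋃ z₀ ∈ {z₀ : ℂ | 0 ≤ z₀.im}, Metric.ball z₀ (aperture w / 2 * ‖z₀‖) := by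
    ext z; simp [sector, dist_eq_norm]
  rw [this]
  exact isOpen_biUnion fun _ _ => Metric.isOpen_ball

lemma mem_sector {w z : ℂ} (hw : w ∈ upperHalf) (hz : 0 ≤ z.im) (hz0 : z ≠ 0) : z ∈ sector w := by
  have := aperture_pos hw
  have := norm_pos_iff.2 hz0
  exact ⟨z, hz, by simp; positivity⟩

lemma half_aperture_mul_le {w z z₀ : ℂ} (hw : w ∈ upperHalf) (hz₀ : 0 ≤ z₀.im)
    (hz : ‖z - z₀‖ < aperture w / 2 * ‖z₀‖) {x y : ℝ} (hx : 0 ≤ x) (hy : 0 ≤ y) :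
    aperture w / 2 * (y * ‖z₀‖ + x * ‖w‖) ≤ ‖(y : ℂ) * z - x * (starRingEnd ℂ) w‖ := by
  have h1 := aperture_mul_le hw hz₀ hx hy
  have h2 : ‖(y : ℂ) * z₀ - x * (starRingEnd ℂ) w‖ - ‖(y : ℂ) * (z - z₀)‖ ≤
      ‖(y : ℂ) * z - x * (starRingEnd ℂ) w‖ := by
    rw [sub_le_iff_le_add]
    refine le_trans (le_of_eq ?_) (norm_sub_le _ _)
    congr 1; ring
  rw [norm_mul, Complex.norm_real, Real.norm_of_nonneg hy] at h2
  have := aperture_pos hw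
  nlinarith [mul_le_mul_of_nonneg_left hz.le hy, mul_nonneg (mul_nonneg this.le hx) (norm_nonneg w)]

/-- The `k`-th derivative in `z` of `kernelIntegrand (m + 1) z w x y`, at `p = (x, y)`. -/
noncomputable def kernelIntegrandDeriv (m k : ℕ) (w z : ℂ) (p : ℝ × ℝ) : ℂ :=
  (1 - (p.2 : ℂ)) ^ m * (1 - (p.1 : ℂ)) ^ m * (I * ((-1) ^ k * k.factorial * (p.2 : ℂ) ^ k /
    ((p.2 : ℂ) * z - (p.1 : ℂ) * (starRingEnd ℂ) w) ^ (k + 1)))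

lemma measurable_kernelIntegrandDeriv (m k : ℕ) (w z : ℂ) :
    Measurable (kernelIntegrandDeriv m k w z) := by
  unfold kernelIntegrandDeriv; fun_prop

lemma hasDerivAt_kernelIntegrandDeriv (m k : ℕ) {w z : ℂ} {p : ℝ × ℝ}
    (h : (p.2 : ℂ) * z - (p.1 : ℂ) * (starRingEnd ℂ) w ≠ 0) :
    HasDerivAt (fun z => kernelIntegrandDeriv m k w z p)
        (kernelIntegrandDeriv m (k + 1) w z p) z := by
  unfold kernelIntegrandDeriv
  have h1 : HasDerivAt (fun z : ℂ => (p.2 : ℂ) * z - (p.1 : ℂ) * (starRingEnd ℂ) w) p.2 z := by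
    simpa using ((hasDerivAt_id z).const_mul (p.2 : ℂ)).sub_const ((p.1 : ℂ) * (starRingEnd ℂ) w)
  refine ((((hasDerivAt_const z ((-1) ^ k * k.factorial * (p.2 : ℂ) ^ k)).div (h1.pow (k + 1))
    (pow_ne_zero _ h)).const_mul I).const_mul _).congr_deriv ?_
  simp only [Nat.factorial_succ, Pi.pow_apply]
  push_cast
  field_simp
  ring

/-- The weighted inequality of arithmetic and geometric means, which separates the variables in the
kernel bound. -/
lemma one_div_add_le {a b s : ℝ} (ha : 0 < a) (hb : 0 < b) (hs : s ∈ Icc (0 : ℝ) 1) :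
    1 / (a + b) ≤ a ^ (-s) * b ^ (s - 1) := by
  have h := Real.geom_mean_le_arith_mean2_weighted hs.1 (sub_nonneg.2 hs.2) ha.le hb.le (by ring)
  have h2 : a ^ s * b ^ (1 - s) ≤ a + b := h.trans (by nlinarith [hs.1, hs.2])
  rw [Real.rpow_neg ha.le, show s - 1 = -(1 - s) by ring, Real.rpow_neg hb.le, ← mul_inv, one_div]
  gcongr

lemma norm_one_sub_le_one {x : ℝ} (hx : x ∈ Ioc (0 : ℝ) 1) : ‖1 - (x : ℂ)‖ ≤ 1 := by
  rw [show (1 - (x : ℂ)) = ((1 - x : ℝ) : ℂ) by push_cast; ring, Complex.norm_real,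
    Real.norm_eq_abs, abs_le]
  constructor <;> linarith [hx.1, hx.2]

/-- The bound for all derivatives of the integrand, as a product of powers of `x` and `y` that are
integrable at `0` for `0 < s < 1`. Here `r` is the modulus of a point comparable to `z`. -/
lemma norm_kernelIntegrandDeriv_le (m k : ℕ) {w z : ℂ} {d r s : ℝ} (hd : 0 < d) (hr : 0 < r)
    (hw : w ≠ 0)
    (hs : s ∈ Icc (0 : ℝ) 1) {p : ℝ × ℝ} (hp1 : p.1 ∈ Ioc (0 : ℝ) 1) (hp2 : p.2 ∈ Ioc (0 : ℝ) 1)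
    (h : d * (p.2 * r + p.1 * ‖w‖) ≤ ‖(p.2 : ℂ) * z - p.1 * (starRingEnd ℂ) w‖) :
    ‖kernelIntegrandDeriv m k w z p‖ ≤
      k.factorial / d ^ (k + 1) * ‖w‖ ^ (s - 1) * (r ^ k)⁻¹ * r ^ (-s) *
          (p.1 ^ (s - 1) * p.2 ^ (-s)) := by
  obtain ⟨x, y⟩ := p
  simp only at *
  have hx := hp1.1
  have hy := hp2.1
  have hwn := norm_pos_iff.2 hw
  have h1 := one_div_add_le (mul_pos hy hr) (mul_pos hx hwn) hs
  rw [Real.mul_rpow hy.le hr.le, Real.mul_rpow hx.le hwn.le] at h1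
  unfold kernelIntegrandDeriv
  simp only [norm_mul, norm_div, norm_pow, norm_neg, norm_one, one_pow, one_mul, norm_I,
    Complex.norm_natCast, Complex.norm_real, Real.norm_of_nonneg hy.le]
  have e1 : ‖1 - (y : ℂ)‖ ^ m ≤ 1 := pow_le_one₀ (norm_nonneg _) (norm_one_sub_le_one hp2)
  have e2 : ‖1 - (x : ℂ)‖ ^ m ≤ 1 := pow_le_one₀ (norm_nonneg _) (norm_one_sub_le_one hp1)
  have hyr : y * r ≤ y * r + x * ‖w‖ := by have := mul_pos hx hwn; linarith
  have hyr0 := mul_pos hy hr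
  calc _ ≤ 1 * 1 * (k.factorial * y ^ k / (d * (y * r + x * ‖w‖)) ^ (k + 1)) := by gcongr
    _ = k.factorial / d ^ (k + 1) * (y ^ k / (y * r + x * ‖w‖) ^ k) * (1 / (y * r + x * ‖w‖)) := by
        rw [mul_pow, pow_succ (y * r + x * ‖w‖)]
        field_simp
    _ ≤ k.factorial / d ^ (k + 1) * (y ^ k / (y * r) ^ k) *
        (y ^ (-s) * r ^ (-s) * (x ^ (s - 1) * ‖w‖ ^ (s - 1))) := by gcongr
    _ = _ := by
        rw [mul_pow]; field_simp

/-- Lebesgue measure on the unit square. -/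
noncomputable def squareMeasure : Measure (ℝ × ℝ) :=
  (volume.restrict (Ioc (0 : ℝ) 1)).prod (volume.restrict (Ioc (0 : ℝ) 1))

lemma squareMeasure_eq : squareMeasure = volume.restrict (Ioc (0 : ℝ) 1 ×ˢ Ioc (0 : ℝ) 1) := by
  rw [squareMeasure, Measure.prod_restrict, ← Measure.volume_eq_prod]

lemma ae_squareMeasure : ∀ᵐ p ∂squareMeasure, p.1 ∈ Ioc (0 : ℝ) 1 ∧ p.2 ∈ Ioc (0 : ℝ) 1 := by
  rw [squareMeasure_eq]
  filter_upwards [ae_restrict_mem (measurableSet_Ioc.prod measurableSet_Ioc)] with p hp using hp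

lemma integrable_rpow_Ioc {s : ℝ} (hs : -1 < s) :
    Integrable (fun x : ℝ => x ^ s) (volume.restrict (Ioc (0 : ℝ) 1)) :=
  (intervalIntegrable_iff_integrableOn_Ioc_of_le zero_le_one).1
          (intervalIntegral.intervalIntegrable_rpow' hs)

lemma integrable_square_rpow {s : ℝ} (hs : s ∈ Ioo (0 : ℝ) 1) :
    Integrable (fun p : ℝ × ℝ => p.1 ^ (s - 1) * p.2 ^ (-s)) squareMeasure :=
  (integrable_rpow_Ioc (by linarith [hs.1])).mul_prod (integrable_rpow_Ioc (by linarith [hs.2]))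

lemma ne_zero_of_mem_upperHalf {w : ℂ} (hw : w ∈ upperHalf) : w ≠ 0 := by
  rintro rfl; simp [mem_upperHalf] at hw

lemma norm_pos_of_lt {w z z₀ : ℂ} (h : ‖z - z₀‖ < aperture w / 2 * ‖z₀‖) : 0 < ‖z₀‖ := by
  rw [norm_pos_iff]; rintro rfl; simp at h; linarith [norm_nonneg z]

lemma integrable_kernelIntegrandDeriv (m k : ℕ) {w z : ℂ} (hw : w ∈ upperHalf) (hz : z ∈ sector w) :
    Integrable (kernelIntegrandDeriv m k w z) squareMeasure := by
  obtain ⟨z₀, hz₀, hzz⟩ := hz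
  refine Integrable.mono' ((integrable_square_rpow (s := 1 / 2) (by norm_num)).const_mul
    (k.factorial / (aperture w / 2) ^ (k + 1) * ‖w‖ ^ ((1 / 2 : ℝ) - 1) * (‖z₀‖ ^ k)⁻¹ *
      ‖z₀‖ ^ (-(1 / 2) : ℝ)))
    (measurable_kernelIntegrandDeriv m k w z).aestronglyMeasurable ?_
  filter_upwards [ae_squareMeasure] with p hp
  exact norm_kernelIntegrandDeriv_le m k (half_pos (aperture_pos hw)) (norm_pos_of_lt hzz)
    (ne_zero_of_mem_upperHalf hw) (by norm_num) hp.1 hp.2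
    (half_aperture_mul_le hw hz₀ hzz hp.1.1.le hp.2.1.le)

lemma denom_ne_zero {w z : ℂ} (hw : w ∈ upperHalf) (hz : z ∈ sector w) {x y : ℝ} (hx : 0 ≤ x)
    (hy : 0 < y) :
    (y : ℂ) * z - x * (starRingEnd ℂ) w ≠ 0 := by
  obtain ⟨z₀, hz₀, hzz⟩ := hz
  rw [← norm_pos_iff]
  refine lt_of_lt_of_le ?_ (half_aperture_mul_le hw hz₀ hzz hx hy.le)
  have := aperture_pos hw
  have := norm_pos_of_lt hzz
  positivity

/-- The `k`-th derivative in `z` of the double integral in `kernel (m + 1) z w`, taken under the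
integral sign. -/
noncomputable def kernelDeriv (m k : ℕ) (w z : ℂ) : ℂ := ∫ p,
    kernelIntegrandDeriv m k w z p ∂squareMeasure

lemma hasDerivAt_kernelDeriv (m k : ℕ) {w z : ℂ} (hw : w ∈ upperHalf) (hz : z ∈ sector w) :
    HasDerivAt (kernelDeriv m k w) (kernelDeriv m (k + 1) w z) z := by
  obtain ⟨z₀, hz₀, hzz⟩ := id hz
  have hs : Metric.ball z₀ (aperture w / 2 * ‖z₀‖) ∈ 𝓝 z :=
    Metric.isOpen_ball.mem_nhds (by rwa [Metric.mem_ball, dist_eq_norm])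
  refine (hasDerivAt_integral_of_dominated_loc_of_deriv_le hs ?_ ?_ ?_ ?_
    ((integrable_square_rpow (s := 1 / 2) (by norm_num)).const_mul
    ((k + 1).factorial / (aperture w / 2) ^ (k + 1 + 1) * ‖w‖ ^ ((1 / 2 : ℝ) - 1) *
      (‖z₀‖ ^ (k + 1))⁻¹ * ‖z₀‖ ^ (-(1 / 2) : ℝ))) ?_).2
  · exact Eventually.of_forall fun z => (measurable_kernelIntegrandDeriv m k w
        z).aestronglyMeasurable
  · exact integrable_kernelIntegrandDeriv m k hw hz
  · exact (measurable_kernelIntegrandDeriv m (k + 1) w z).aestronglyMeasurable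
  · filter_upwards [ae_squareMeasure] with p hp u hu
    rw [Metric.mem_ball, dist_eq_norm] at hu
    exact norm_kernelIntegrandDeriv_le m (k + 1) (half_pos (aperture_pos hw)) (norm_pos_of_lt hzz)
      (ne_zero_of_mem_upperHalf hw) (by norm_num) hp.1 hp.2
      (half_aperture_mul_le hw hz₀ hu hp.1.1.le hp.2.1.le)
  · filter_upwards [ae_squareMeasure] with p hp u hu
    rw [Metric.mem_ball, dist_eq_norm] at hu
    exact hasDerivAt_kernelIntegrandDeriv m k (denom_ne_zero hw ⟨z₀, hz₀, hu⟩ hp.1.1.le hp.2.1)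

lemma exists_norm_kernelDeriv_le (m k : ℕ) {w : ℂ} (hw : w ∈ upperHalf) {s : ℝ}
    (hs : s ∈ Ioo (0 : ℝ) 1) :
    ∃ C : ℝ, 0 ≤ C ∧ ∀ z : ℂ, 0 ≤ z.im → z ≠ 0 → ‖z ^ k * kernelDeriv m k w z‖ ≤ C * ‖z‖ ^ (-s) := by
  have hap := aperture_pos hw
  refine ⟨k.factorial / aperture w ^ (k + 1) * ‖w‖ ^ (s - 1) *
    ∫ p, p.1 ^ (s - 1) * p.2 ^ (-s) ∂squareMeasure, ?_, fun z hz hz0 => ?_⟩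
  · refine mul_nonneg (by positivity) (integral_nonneg_of_ae ?_)
    filter_upwards [ae_squareMeasure] with p hp
    exact mul_nonneg (Real.rpow_nonneg hp.1.1.le _) (Real.rpow_nonneg hp.2.1.le _)
  · have hzn := norm_pos_iff.2 hz0
    have h1 : ‖kernelDeriv m k w z‖ ≤ ∫ p, k.factorial / aperture w ^ (k + 1) * ‖w‖ ^ (s - 1) *
        (‖z‖ ^ k)⁻¹ * ‖z‖ ^ (-s) * (p.1 ^ (s - 1) * p.2 ^ (-s)) ∂squareMeasure := by
      refine norm_integral_le_of_norm_le ((integrable_square_rpow hs).const_mul _) ?_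
      filter_upwards [ae_squareMeasure] with p hp
      exact norm_kernelIntegrandDeriv_le m k hap hzn (ne_zero_of_mem_upperHalf hw)
          (Ioo_subset_Icc_self hs)
        hp.1 hp.2 (aperture_mul_le hw hz hp.1.1.le hp.2.1.le)
    rw [integral_const_mul] at h1
    rw [norm_mul, norm_pow]
    refine (mul_le_mul_of_nonneg_left h1 (by positivity)).trans (le_of_eq ?_)
    field_simp

lemma kernelIntegrandDeriv_zero (m : ℕ) (w z : ℂ) (p : ℝ × ℝ) :
    kernelIntegrandDeriv m 0 w z p = kernelIntegrand (m + 1) z w p.1 p.2 := by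
  simp [kernelIntegrandDeriv, kernelIntegrand, div_eq_mul_inv]

lemma kernel_eq (m : ℕ) {w z : ℂ} (hw : w ∈ upperHalf) (hz : z ∈ sector w) :
    kernel (m + 1) z w = 1 / (m.factorial : ℂ) ^ 2 * kernelDeriv m 0 w z := by
  rw [kernel, kernelDeriv, squareMeasure,
    integral_prod_symm _ (integrable_kernelIntegrandDeriv m 0 hw hz)]
  simp only [kernelIntegrandDeriv_zero, intervalIntegral.integral_of_le (zero_le_one' ℝ),
    Nat.add_sub_cancel]

lemma iteratedDeriv_kernel (m k : ℕ) {w z : ℂ} (hw : w ∈ upperHalf) (hz : z ∈ sector w) :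
    iteratedDeriv k (fun z => kernel (m + 1) z w) z =
        1 / (m.factorial : ℂ) ^ 2 * kernelDeriv m k w z := by
  induction k generalizing z with
  | zero => simpa using kernel_eq m hw hz
  | succ k ih =>
    have h1 : iteratedDeriv k (fun z => kernel (m + 1) z w) =ᶠ[𝓝 z]
        fun z => 1 / (m.factorial : ℂ) ^ 2 * kernelDeriv m k w z := by
      filter_upwards [(isOpen_sector w).mem_nhds hz] with u hu using ih hu
    rw [iteratedDeriv_succ, h1.deriv_eq, ((hasDerivAt_kernelDeriv m k hw hz).const_mul _).deriv]

lemma kernel_mem_hardySobolev (m : ℕ) {w : ℂ} (hw : w ∈ upperHalf) (n : ℕ) :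
    (fun z => kernel (m + 1) z w) ∈ hardySobolev n := by
  have hsub : ∀ z ∈ upperHalf, z ∈ sector w := fun z hz =>
    mem_sector hw (le_of_lt hz) (ne_zero_of_mem_upperHalf hz)
  have hdiff : ∀ k, DifferentiableOn ℂ (fun z => 1 / (m.factorial : ℂ) ^ 2 * kernelDeriv m k w z)
      upperHalf :=
    fun k z hz => ((hasDerivAt_kernelDeriv m k hw (hsub z hz)).const_mul
        _).differentiableAt.differentiableWithinAt
  refine ⟨(hdiff 0).congr fun z hz => kernel_eq m hw (hsub z hz), fun k _ => ?_⟩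
  obtain ⟨C₁, h₁, hC₁⟩ := exists_norm_kernelDeriv_le m k hw (s := 1 / 4) (by norm_num)
  obtain ⟨C₂, h₂, hC₂⟩ := exists_norm_kernelDeriv_le m k hw (s := 3 / 4) (by norm_num)
  refine mem_hardy_of_norm_le (C := ‖1 / (m.factorial : ℂ) ^ 2‖ * max C₁ C₂) ?_ fun z hz s hs => ?_
  · exact (differentiableOn_id.pow k).mul
        ((hdiff k).congr fun z hz => iteratedDeriv_kernel m k hw (hsub z hz))
  · rw [iteratedDeriv_kernel m k hw (hsub z hz), mul_left_comm, norm_mul, mul_assoc]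
    gcongr
    have hz0 := ne_zero_of_mem_upperHalf hz
    rcases hs with rfl | rfl
    · exact (hC₁ z (le_of_lt hz) hz0).trans (by gcongr; exact le_max_left _ _)
    · exact (hC₂ z (le_of_lt hz) hz0).trans (by gcongr; exact le_max_right _ _)

/-- The antiderivative is `((1 - x) / (a - x b)) ^ (m + 1)`, up to a constant. -/
lemma integral_one_sub_pow_div (m : ℕ) {a b : ℂ} (h : ∀ x ∈ Icc (0 : ℝ) 1, a - x * b ≠ 0) :
    ∫ x in (0 : ℝ)..1, (1 - (x : ℂ)) ^ m / (a - x * b) ^ (m + 2) =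
      ((m + 1) * (a ^ (m + 1) * (a - b)))⁻¹ := by
  have ha : a ≠ 0 := by simpa using h 0 (by simp)
  have hab : a - b ≠ 0 := by simpa using h 1 (by simp)
  have hba : b - a ≠ 0 := by rw [← neg_sub]; exact neg_ne_zero.2 hab
  have hm : (m : ℂ) + 1 ≠ 0 := by exact_mod_cast m.succ_ne_zero
  have hd : ∀ x ∈ uIcc (0 : ℝ) 1, HasDerivAt
      (fun x : ℝ => ((m + 1) * (b - a))⁻¹ * ((1 - (x : ℂ)) / (a - x * b)) ^ (m + 1))
      ((1 - (x : ℂ)) ^ m / (a - x * b) ^ (m + 2)) x := by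
    intro x hx
    rw [uIcc_of_le zero_le_one] at hx
    have hx := h x hx
    have h1 : HasDerivAt (fun x : ℝ => 1 - (x : ℂ)) (-1) x := by
      simpa using (Complex.ofRealCLM.hasDerivAt (x := x)).const_sub 1
    have h2 : HasDerivAt (fun x : ℝ => a - (x : ℂ) * b) (-b) x := by
      simpa using ((Complex.ofRealCLM.hasDerivAt (x := x)).mul_const b).const_sub a
    refine (((h1.div h2 hx).pow (m + 1)).const_mul _).congr_deriv ?_
    simp only [Pi.div_apply, Nat.add_sub_cancel]
    push_cast
    rw [div_pow]
    field_simp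
    ring
  have hc : ContinuousOn (fun x : ℝ => (1 - (x : ℂ)) ^ m / (a - x * b) ^ (m + 2)) (uIcc 0 1) := by
    refine ContinuousOn.div (by fun_prop) (by fun_prop) fun x hx => pow_ne_zero _ (h x ?_)
    rwa [uIcc_of_le zero_le_one] at hx
  rw [intervalIntegral.integral_eq_sub_of_hasDerivAt hd hc.intervalIntegrable]
  simp
  field_simp
  ring

/-- `z ^ n * K⁽ⁿ⁾(z)` for the kernel `K` of order `n = m + 1`, as a single integral: one integration
undoes the `n` derivatives. -/
lemma pow_mul_kernelDeriv (m : ℕ) {w z : ℂ} (hw : w ∈ upperHalf) (hz : z ∈ sector w) :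
    z ^ (m + 1) * (1 / (m.factorial : ℂ) ^ 2 * kernelDeriv m (m + 1) w z) =
      (-1) ^ (m + 1) / m.factorial *
        ∫ y in (0 : ℝ)..1, (1 - (y : ℂ)) ^ m * (I / (y * z - (starRingEnd ℂ) w)) := by
  have hz0 : z ≠ 0 := by
    have := denom_ne_zero hw hz le_rfl one_pos
    simpa using this
  have hf : (m.factorial : ℂ) ≠ 0 := by exact_mod_cast m.factorial_ne_zero
  have hm : (m : ℂ) + 1 ≠ 0 := by exact_mod_cast m.succ_ne_zero
  have e : kernelDeriv m (m + 1) w z = ∫ y in Ioc (0 : ℝ) 1,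
      ((-1) ^ (m + 1) * m.factorial / z ^ (m + 1)) *
      ((1 - (y : ℂ)) ^ m * (I / (y * z - (starRingEnd ℂ) w))) := by
    rw [kernelDeriv, squareMeasure, integral_prod_symm _
        (integrable_kernelIntegrandDeriv m (m + 1) hw hz)]
    refine setIntegral_congr_fun measurableSet_Ioc fun y hy => ?_
    have hyC : (y : ℂ) ≠ 0 := by exact_mod_cast hy.1.ne'
    have hne : (y : ℂ) * z - (starRingEnd ℂ) w ≠ 0 :=
        by simpa using denom_ne_zero hw hz zero_le_one hy.1
    have h1 := integral_one_sub_pow_div m (a := y * z) (b := (starRingEnd ℂ) w)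
      fun x hx => denom_ne_zero hw hz hx.1 hy.1
    rw [intervalIntegral.integral_of_le zero_le_one] at h1
    have h2 : ∀ x : ℝ, kernelIntegrandDeriv m (m + 1) w z (x, y) =
        ((1 - (y : ℂ)) ^ m * (I * ((-1) ^ (m + 1) * (m + 1).factorial * (y : ℂ) ^ (m + 1)))) *
          ((1 - (x : ℂ)) ^ m / (y * z - x * (starRingEnd ℂ) w) ^ (m + 2)) := by
      intro x; simp only [kernelIntegrandDeriv]; ring
    simp only [h2]
    rw [integral_const_mul, h1, Nat.factorial_succ]
    push_cast
    rw [mul_pow]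
    field_simp
  rw [e, integral_const_mul, ← intervalIntegral.integral_of_le zero_le_one]
  generalize ∫ y in (0 : ℝ)..1, (1 - (y : ℂ)) ^ m * (I / (y * z - (starRingEnd ℂ) w)) = J
  field_simp

/-! ### The reproducing property -/

section

variable {F : ℂ → ℂ} {w : ℂ}

lemma iteratedDeriv_boundary_eventuallyEq {n : ℕ} (hF : F ∈ hardySobolev n) {k : ℕ}
    (hk : k < n) {x : ℝ}
    (hx : x ≠ 0) : iteratedDeriv k (boundary F) =ᶠ[𝓝 x] boundary (iteratedDeriv k F) := by
  filter_upwards [isOpen_compl_singleton.mem_nhds hx] with u hu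
  exact iteratedDeriv_boundary hF hk hu

lemma ae_differentiableAt_iteratedDeriv_boundary {n : ℕ} (hF : F ∈ hardySobolev n) {k : ℕ}
    (hk : k < n) :
    ∀ᵐ x : ℝ, DifferentiableAt ℝ (iteratedDeriv k (boundary F)) x := by
  rcases Nat.lt_or_ge (k + 1) n with h | h
  · have hx0 : ∀ᵐ x : ℝ, x ≠ 0 := by simp [ae_iff, measure_singleton]
    filter_upwards [hx0] with x hx
    exact ((hasDerivAt_boundary hF h hx).congr_of_eventuallyEq
      (iteratedDeriv_boundary_eventuallyEq hF hk hx)).differentiableAt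
  · obtain rfl : n = k + 1 := by omega
    obtain ⟨U, g, hg⟩ := hardy_exists_isWeakBoundary (hF.2 (k + 1) le_rfl)
    filter_upwards [ae_hasDerivAt_boundary hF hg] with x hx
    exact (hx.2.congr_of_eventuallyEq
      (iteratedDeriv_boundary_eventuallyEq hF hk hx.1)).differentiableAt

lemma ae_iteratedDeriv_boundary_eq {m : ℕ}
    (hF : F ∈ hardySobolev (m + 1)) {U : Ultrafilter ℝ} {g : ℝ → ℂ}
    (hg : IsWeakBoundary (fun z => z ^ (m + 1) * iteratedDeriv (m + 1) F z) U g) :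
    ∀ᵐ x : ℝ, x ≠ 0 ∧ iteratedDeriv (m + 1) (boundary F) x = g x / (x : ℂ) ^ (m + 1) := by
  filter_upwards [ae_hasDerivAt_boundary hF hg] with x hx
  refine ⟨hx.1, ?_⟩
  rw [iteratedDeriv_succ, (iteratedDeriv_boundary_eventuallyEq hF
      (Nat.lt_succ_self m) hx.1).deriv_eq,
    hx.2.deriv]

/-- The boundary derivatives of the kernel are its complex derivatives at real points, as the kernel
is holomorphic across the real line off the origin. -/
lemma iteratedDeriv_boundary_kernel (m : ℕ) (hw : w ∈ upperHalf) {x : ℝ} (hx : x ≠ 0) :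
    iteratedDeriv (m + 1) (boundary fun z => kernel (m + 1) z w) x =
      1 / (m.factorial : ℂ) ^ 2 * kernelDeriv m (m + 1) w x := by
  have hK := kernel_mem_hardySobolev m hw (m + 1)
  have hS : ∀ u : ℝ, u ≠ 0 → (u : ℂ) ∈ sector w := fun u hu =>
    mem_sector hw (by simp) (by exact_mod_cast hu)
  have h1 : iteratedDeriv m (boundary fun z => kernel (m + 1) z w) =ᶠ[𝓝 x]
      fun u : ℝ => 1 / (m.factorial : ℂ) ^ 2 * kernelDeriv m m w u := by
    filter_upwards [isOpen_compl_singleton.mem_nhds hx] with u hu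
    rw [iteratedDeriv_boundary hK (Nat.lt_succ_self m) hu]
    refine tendsto_nhds_unique (tendsto_boundary hK (Nat.lt_succ_self m) hu) ?_
    have hc : ContinuousAt (fun z => 1 / (m.factorial : ℂ) ^ 2 * kernelDeriv m m w z)
        (u + (0 : ℝ) * I) := by
      rw [ofReal_zero, zero_mul, add_zero]
      exact ((hasDerivAt_kernelDeriv m m hw (hS u hu)).const_mul _).continuousAt
    have hc2 : ContinuousAt (fun y : ℝ =>
        1 / (m.factorial : ℂ) ^ 2 * kernelDeriv m m w (u + y * I)) 0 :=
      ContinuousAt.comp (f := fun y : ℝ => (u : ℂ) + y * I) hc (by fun_prop)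
    have := hc2.tendsto.mono_left (nhdsWithin_le_nhds (s := Ioi 0))
    simp only [ofReal_zero, zero_mul, add_zero] at this
    refine this.congr' ?_
    filter_upwards [self_mem_nhdsWithin] with y hy
    have hy' := mem_upperHalf_line hy u
    exact (iteratedDeriv_kernel m m hw (mem_sector hw (le_of_lt hy')
        (ne_zero_of_mem_upperHalf hy'))).symm
  rw [iteratedDeriv_succ, h1.deriv_eq]
  exact (((hasDerivAt_kernelDeriv m m hw (hS x hx)).const_mul _).comp_ofReal).deriv

lemma conj_pow_mul_kernelDeriv (m : ℕ) (hw : w ∈ upperHalf) {x : ℝ} (hx : x ≠ 0) :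
    (starRingEnd ℂ) ((x : ℂ) ^ (m + 1) * (1 / (m.factorial : ℂ) ^ 2 * kernelDeriv m (m + 1) w x)) =
      (-1) ^ (m + 1) / m.factorial *
        ∫ y in Ioc (0 : ℝ) 1, (1 - (y : ℂ)) ^ m * (-I / (y * x - w)) := by
  rw [pow_mul_kernelDeriv m hw (mem_sector hw (by simp) (by exact_mod_cast hx)), map_mul,
    intervalIntegral.integral_of_le zero_le_one, ← integral_conj]
  congr 1
  · simp
  · simp

/-- The Cauchy kernel at `w / y` is dominated by a product of an `L²` function of `x` and an
integrable function of `y`. -/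
lemma exists_norm_inv_le (hw : w ∈ upperHalf) :
    ∃ C : ℝ, 0 ≤ C ∧ ∀ x : ℝ, x ≠ 0 → ∀ y ∈ Ioc (0 : ℝ) 1,
      ‖((y : ℂ) * x - w)⁻¹‖ ≤ C * (envelope x * y ^ (-(3 / 4) : ℝ)) := by
  have hap := aperture_pos hw
  have hwn := norm_pos_iff.2 (ne_zero_of_mem_upperHalf hw)
  refine ⟨(aperture w)⁻¹ * max (‖w‖ ^ ((1 / 4 : ℝ) - 1)) (‖w‖ ^ ((3 / 4 : ℝ) - 1)), by positivity,
    fun x hx y hy => ?_⟩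
  have hxa := abs_pos.2 hx
  have h1 := aperture_mul_le hw (z := x) (x := 1) (by simp) zero_le_one hy.1.le
  have e : ‖(y : ℂ) * x - (1 : ℝ) * (starRingEnd ℂ) w‖ = ‖(y : ℂ) * x - w‖ := by
    rw [← RCLike.norm_conj]; simp
  rw [e, Complex.norm_real, Real.norm_eq_abs, one_mul] at h1
  have hyx := mul_pos hy.1 hxa
  have h2 : ‖((y : ℂ) * x - w)⁻¹‖ ≤ (aperture w)⁻¹ * (1 / (y * |x| + ‖w‖)) := by
    rw [norm_inv, one_div, ← mul_inv]; gcongr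
  have h3 : ∀ s ∈ ({1 / 4, 3 / 4} : Set ℝ), 1 / (y * |x| + ‖w‖) ≤
      max (‖w‖ ^ ((1 / 4 : ℝ) - 1)) (‖w‖ ^ ((3 / 4 : ℝ) - 1)) *
          (|x| ^ (-s) * y ^ (-(3 / 4) : ℝ)) := by
    intro s hs
    have hs' : s ∈ Icc (0 : ℝ) 1 ∧ s ≤ 3 / 4 := by rcases hs with rfl | rfl <;> norm_num
    refine (one_div_add_le hyx hwn hs'.1).trans ?_
    rw [Real.mul_rpow hy.1.le hxa.le, mul_comm, mul_comm (y ^ (-s))]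
    have h4 : ‖w‖ ^ (s - 1) ≤ max (‖w‖ ^ ((1 / 4 : ℝ) - 1)) (‖w‖ ^ ((3 / 4 : ℝ) - 1)) := by
      rcases hs with rfl | rfl
      · exact le_max_left _ _
      · exact le_max_right _ _
    have h5 : y ^ (-s) ≤ y ^ (-(3 / 4) : ℝ) :=
      Real.rpow_le_rpow_of_exponent_ge hy.1 hy.2 (by linarith [hs'.2])
    have hy0 := hy.1
    gcongr
  rw [mul_assoc]
  refine h2.trans (mul_le_mul_of_nonneg_left ?_ (by positivity))
  rw [envelope, min_mul_of_nonneg _ _ (Real.rpow_nonneg hy.1.le _),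
      mul_min_of_nonneg _ _ (by positivity)]
  exact le_min (h3 _ (by simp)) (h3 _ (by simp))

/-- Absolute convergence for the exchange of integrals in the reproducing formula. -/
lemma integrable_mul_cauchy (m : ℕ) (hw : w ∈ upperHalf) {g : ℝ → ℂ} (hg : MemLp g 2) :
    Integrable (fun p : ℝ × ℝ => g p.1 * ((1 - (p.2 : ℂ)) ^ m * (-I / (p.2 * p.1 - w))))
      ((volume : Measure ℝ).prod (volume.restrict (Ioc (0 : ℝ) 1))) := by
  obtain ⟨C, hC0, hC⟩ := exists_norm_inv_le hw
  have h1 : Integrable (fun x => ‖g x‖ * envelope x) := hg.norm.integrable_mul memLp_envelope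
  have h2 := (h1.mul_prod (integrable_rpow_Ioc (s := -(3 / 4)) (by norm_num))).const_mul C
  refine h2.mono' ?_ ?_
  · refine AEStronglyMeasurable.mul hg.aestronglyMeasurable.comp_fst ?_
    exact Measurable.aestronglyMeasurable (by fun_prop)
  · have hx0 : ∀ᵐ x : ℝ, x ≠ 0 := by simp [ae_iff, measure_singleton]
    have hy : ∀ᵐ y ∂(volume.restrict (Ioc (0 : ℝ) 1)), y ∈ Ioc (0 : ℝ) 1 :=
      ae_restrict_mem measurableSet_Ioc
    filter_upwards [Measure.quasiMeasurePreserving_fst.ae hx0,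
        Measure.quasiMeasurePreserving_snd.ae hy]
      with p hp1 hp2
    have h3 := hC p.1 hp1 p.2 hp2
    have h4 : ‖1 - (p.2 : ℂ)‖ ^ m ≤ 1 := pow_le_one₀ (norm_nonneg _) (norm_one_sub_le_one hp2)
    rw [norm_mul, norm_mul, div_eq_mul_inv, norm_mul, norm_neg, norm_I, one_mul, norm_pow]
    calc _ ≤ ‖g p.1‖ * (1 * (C * (envelope p.1 * p.2 ^ (-(3 / 4) : ℝ)))) := by gcongr
      _ = _ := by ring

/-- Cauchy's formula at the point `w / y`, rescaled. -/
lemma integral_mul_cauchy {f : ℂ → ℂ} (hf : f ∈ hardy) {U : Ultrafilter ℝ} {g : ℝ → ℂ}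
    (hg : IsWeakBoundary f U g) (hw : w ∈ upperHalf) {y : ℝ} (hy : 0 < y) :
    ∫ x : ℝ, g x * (-I / (y * x - w)) = 2 * Real.pi * ((y : ℂ)⁻¹ * f (w / y)) := by
  have hyC : (y : ℂ) ≠ 0 := by exact_mod_cast hy.ne'
  have h1 := hg.integral_div_sub hf (div_ofReal_mem_upperHalf hw hy)
  have e : ∀ x : ℝ, g x * (-I / (y * x - w)) = (-I * (y : ℂ)⁻¹) * (g x / (x - w / y)) := by
    intro x
    have : (y : ℂ) * x - w = y * (x - w / y) := by field_simp
    rw [this, div_eq_mul_inv, div_eq_mul_inv, mul_inv]; ring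
  simp only [e]
  rw [integral_const_mul, h1]
  linear_combination (-(2 * Real.pi * (y : ℂ)⁻¹ * f (w / y))) * I_mul_I

lemma ae_innerIntegrand_eq {m : ℕ} (hF : F ∈ hardySobolev (m + 1)) {U : Ultrafilter ℝ} {g : ℝ → ℂ}
    (hg : IsWeakBoundary (fun z => z ^ (m + 1) * iteratedDeriv (m + 1) F z) U g)
        (hw : w ∈ upperHalf) :
    innerIntegrand (m + 1) F (fun z => kernel (m + 1) z w) =ᵐ[volume] fun x =>
      (-1) ^ (m + 1) / m.factorial *
        ∫ y in Ioc (0 : ℝ) 1, g x * ((1 - (y : ℂ)) ^ m * (-I / (y * x - w))) := by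
  filter_upwards [ae_iteratedDeriv_boundary_eq hF hg] with x hx
  have hxC : (x : ℂ) ≠ 0 := by exact_mod_cast hx.1
  have h1 := conj_pow_mul_kernelDeriv m hw hx.1
  rw [map_mul, map_pow, conj_ofReal] at h1
  rw [innerIntegrand, hx.2, iteratedDeriv_boundary_kernel m hw hx.1, integral_const_mul,
    mul_left_comm, ← h1, two_mul, pow_add]
  field_simp

lemma integrable_innerIntegrand {m : ℕ} (hF : F ∈ hardySobolev (m + 1)) (hw : w ∈ upperHalf) :
    Integrable (innerIntegrand (m + 1) F (fun z => kernel (m + 1) z w)) := by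
  obtain ⟨U, g, hg⟩ := hardy_exists_isWeakBoundary (hF.2 (m + 1) le_rfl)
  refine Integrable.congr ?_ (ae_innerIntegrand_eq hF hg hw).symm
  exact (integrable_mul_cauchy m hw hg.memLp).integral_prod_left.const_mul _

lemma eq_inner_kernel {m : ℕ} (hF : F ∈ hardySobolev (m + 1)) (hw : w ∈ upperHalf) :
    F w = inner (m + 1) F (fun z => kernel (m + 1) z w) := by
  obtain ⟨U, g, hg⟩ := hardy_exists_isWeakBoundary (hF.2 (m + 1) le_rfl)
  have hpi : (Real.pi : ℂ) ≠ 0 := by exact_mod_cast Real.pi_ne_zero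
  rw [inner, integral_congr_ae (ae_innerIntegrand_eq hF hg hw), integral_const_mul,
    integral_integral_swap (integrable_mul_cauchy m hw hg.memLp)]
  have e : ∫ y in Ioc (0 : ℝ) 1, ∫ x : ℝ, g x * ((1 - (y : ℂ)) ^ m * (-I / (y * x - w))) =
      ∫ y in Ioc (0 : ℝ) 1, 2 * Real.pi * ((1 - (y : ℂ)) ^ m * ((y : ℂ)⁻¹ *
        ((w / y) ^ (m + 1) * iteratedDeriv (m + 1) F (w / y)))) := by
    refine setIntegral_congr_fun measurableSet_Ioc fun y hy => ?_
    simp only [mul_left_comm (g _)]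
    rw [integral_const_mul, integral_mul_cauchy (hF.2 (m + 1) le_rfl) hg hw hy.1]
    ring
  rw [e, integral_const_mul, taylor_integral hF hw, intervalIntegral.integral_of_le zero_le_one]
  field_simp

end

end HardySobolev

theorem theorem3p4 (n : ℕ) (hn : 1 ≤ n) :
    (∀ z ∈ HardySobolev.upperHalf, ∀ w ∈ HardySobolev.upperHalf,
      MeasureTheory.IntegrableOn
        (fun p : ℝ × ℝ => HardySobolev.kernelIntegrand n z w p.1 p.2)
        (Set.Icc (0 : ℝ) 1 ×ˢ Set.Icc (0 : ℝ) 1)) ∧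
    (∀ F ∈ HardySobolev.hardySobolev n,
      (∀ x : ℝ, x ≠ 0 → Filter.Tendsto (fun y : ℝ => F ((x : ℂ) + (y : ℂ) * Complex.I))
        (𝓝[>] (0 : ℝ)) (𝓝 (HardySobolev.boundary F x))) ∧
      ∀ k < n, ∀ᵐ x : ℝ,
        DifferentiableAt ℝ (iteratedDeriv k (HardySobolev.boundary F)) x) ∧
    ∀ w ∈ HardySobolev.upperHalf,
      (fun z : ℂ => HardySobolev.kernel n z w) ∈ HardySobolev.hardySobolev n ∧
      ∀ F ∈ HardySobolev.hardySobolev n,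
        MeasureTheory.Integrable
          (HardySobolev.innerIntegrand n F (fun z : ℂ => HardySobolev.kernel n z w)) ∧
        F w = HardySobolev.inner n F (fun z : ℂ => HardySobolev.kernel n z w) := by
  obtain ⟨m, rfl⟩ : ∃ m, n = m + 1 := ⟨n - 1, by omega⟩
  refine ⟨fun z hz w hw => ?_, fun F hF => ⟨fun x hx => ?_, fun k hk =>
    HardySobolev.ae_differentiableAt_iteratedDeriv_boundary hF hk⟩, fun w hw =>
    ⟨HardySobolev.kernel_mem_hardySobolev m hw _, fun F hF =>
      ⟨HardySobolev.integrable_innerIntegrand hF hw, HardySobolev.eq_inner_kernel hF hw⟩⟩⟩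
  · have h := HardySobolev.integrable_kernelIntegrandDeriv m 0 hw
      (HardySobolev.mem_sector hw (le_of_lt hz) (HardySobolev.ne_zero_of_mem_upperHalf hz))
    simp only [HardySobolev.squareMeasure, MeasureTheory.restrict_Ioc_eq_restrict_Icc] at h
    rw [MeasureTheory.Measure.prod_restrict, ← MeasureTheory.Measure.volume_eq_prod] at h
    exact h.congr (Filter.Eventually.of_forall fun p =>
        HardySobolev.kernelIntegrandDeriv_zero m w z p)
  · simpa using HardySobolev.tendsto_boundary hF hn hx
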